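/- Let $d\ge 1$ and $\gamma=(\gamma_1,\dots,\gamma_{d+1})\in\mathbb R^{d+1}$ with all $\gamma_j>-1$ and $\gamma_1=1$; let $a_0\in\mathbb R$, $a_0\neq 0$. Write $(a)_n=a(a+1)\cdots(a+n-1)$, $|v|$ for the sum of the components of a vector $v$ (with $|v|=0$ for the empty vector), $\boldsymbol\gamma^2=(\gamma_2,\dots,\gamma_{d+1})$, and $\mathbb T^{r}=\{x\in\mathbb R^{r}: x_i\ge 0,\ |x|\le 1\}$. For $\alpha,\beta>-1$ and $n\in\mathbb N_0$ let $$p_n^{\alpha,\beta}(t)=(-1)^n\frac{(\alpha+\beta+1)_n}{n!}\frac{(\beta+1)_n}{(\alpha+1)_n}\sum_{k=0}^n\frac{(-n)_k(n+\alpha+\beta+1)_k}{k!\,(\beta+1)_k}t^k,\qquad p_{-1}^{\alpha,\beta}=0 .$$ The Jacobi polynomials on the simplex are defined recursively in the dimension $r$, for $\delta=(\delta_1,\dots,\delta_{r+1})$ with all $\delta_j>-1$ and $\nu\in\mathbb N_0^r$, by $P=1$ for $r=0$ and, for $r\ge1$, $$P_\nu^{\delta}(x)=p_{\nu_1}^{a_1,\delta_1}(x_1)\,(1-x_1)^{\nu_2+\cdots+\nu_r}\,P_{\nu_2,\dots,\nu_r}^{\delta_2,\dots,\delta_{r+1}}\Big(\tfrac{x_2}{1-x_1},\dots,\tfrac{x_r}{1-x_1}\Big),\qquad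 a_1=2(\nu_2+\cdots+\nu_r)+(\delta_2+\cdots+\delta_{r+1})+r-1 .$$ Put $\alpha=|\boldsymbol\gamma^2|+d-1$ and, for $n,s\in\mathbb N_0$ and $l\in\mathbb Z$, $$\psi_l=(-1)^l\Big(a_0+\frac{(l+1)(l+\alpha+1)}{\alpha+1}\Big),\qquad \hat q_{n,s}(t)=\begin{vmatrix}\psi_{n+s}&p_n^{\alpha+2s,1}(t)\\ \psi_{n+s-1}&p_{n-1}^{\alpha+2s,1}(t)\end{vmatrix}.$$ For $\eta\in\mathbb N_0^d$ let $s=\eta_2+\cdots+\eta_d$ and let $Q_\eta^\gamma$ be the polynomial in $x_1,\dots,x_d$ given by $$Q_\eta^\gamma(x)=\hat q_{\eta_1,s}(x_1)\,(1-x_1)^{s}\,P_{\eta_2,\dots,\eta_d}^{\gamma_2,\dots,\gamma_{d+1}}\Big(\tfrac{x_2}{1-x_1},\dots,\tfrac{x_d}{1-x_1}\Big).$$ Let $$\mathcal M_{2,d}^\gamma=\sum_{k=2}^d(1-x_1-x_k)x_k\partial_{x_k}^2-2\sum_{2\le k<l\le d}x_kx_l\partial_{x_k}\partial_{x_l}+\sum_{k=2}^d\big[(\gamma_k+1)(1-x_1)-(|\boldsymbol\gamma^2|+d)x_k\big]\partial_{x_k}.$$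 **Theorem.** For all $f,g\in\mathbb R[x_1,\dots,x_d]$ the three integrals in $$\begin{aligned}\langle f,g\rangle={}&\int_{\mathbb T^d}f(x)g(x)\,x_2^{\gamma_2}\cdots x_d^{\gamma_d}(1-|x|)^{\gamma_{d+1}}\,dx\\&+\frac1{a_0(|\boldsymbol\gamma^2|+d)}\int_{\mathbb T^{d-1}}f(0,x_2,\dots,x_d)\,g(0,x_2,\dots,x_d)\,x_2^{\gamma_2}\cdots x_d^{\gamma_d}(1-x_2-\cdots-x_d)^{\gamma_{d+1}}\,dx_2\cdots dx_d\\&-\frac1{a_0(|\boldsymbol\gamma^2|+d)}\int_{\mathbb T^d}\mathcal M_{2,d}^\gamma[f](x)\,g(x)\,x_2^{\gamma_2}\cdots x_d^{\gamma_d}(1-|x|)^{\gamma_{d+1}}\,dx\end{aligned}$$ converge absolutely, and the polynomials $Q_\eta^\gamma$ are mutually orthogonal with respect to this Sobolev inner product: $\langle Q_\eta^\gamma,Q_\xi^\gamma\rangle=0$ for all $\eta,\xi\in\mathbb N_0^d$ with $\eta\neq\xi$. (For $d=1$ the second integral is $f(0)g(0)$ and the third is $0$. No positivity is asserted: $a_0$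 may be negative.) -/

import Mathlib

open MeasureTheory

noncomputable section

namespace SimplexKrall

open MvPolynomial

/-- The Pochhammer symbol `(a)_n = a (a + 1) ⋯ (a + n - 1)`. -/
def poch (a : ℝ) (n : ℕ) : ℝ := (ascPochhammer ℝ n).eval a

/-- The Jacobi polynomial
`p_n^{α,β}(t) = (-1)^n (α+β+1)_n / n! · (β+1)_n / (α+1)_n · ₂F₁(-n, n+α+β+1; β+1; t)`. -/
def jacobi (α β : ℝ) (n : ℕ) : Polynomial ℝ :=
  Polynomial.C ((-1) ^ n * (poch (α + β + 1) n / (n.factorial : ℝ)) *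
      (poch (β + 1) n / poch (α + 1) n)) *
    ∑ k ∈ Finset.range (n + 1),
      Polynomial.C (poch (-(n : ℝ)) k * poch ((n : ℝ) + α + β + 1) k /
        ((k.factorial : ℝ) * poch (β + 1) k)) * Polynomial.X ^ k

/-- The Jacobi polynomials indexed by integers, with the convention `p_n^{α,β} = 0` for `n < 0`. -/
def jacobiZ (α β : ℝ) : ℤ → Polynomial ℝ
  | Int.ofNat n => jacobi α β n
  | Int.negSucc _ => 0

/-- `ψ_n^{(0);α,1;a₀} = (-1)^n (a₀ + (n + 1) (n + α + 1) / (α + 1))`, for an integer `n`. -/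
def psi (α a₀ : ℝ) (n : ℤ) : ℝ :=
  (-1) ^ n * (a₀ + ((n : ℝ) + 1) * ((n : ℝ) + α + 1) / (α + 1))

/-- The discrete Wronskian in `n` of `ψ_{n+s}^{(0)}` and `p_n^{α+2s,1}`. -/
def qhat (α a₀ : ℝ) (n s : ℕ) : Polynomial ℝ :=
  Matrix.det
    !![Polynomial.C (psi α a₀ ((n : ℤ) + s)), jacobiZ (α + 2 * s) 1 (n : ℤ);
       Polynomial.C (psi α a₀ ((n : ℤ) + s - 1)), jacobiZ (α + 2 * s) 1 ((n : ℤ) - 1)]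

/-- For a polynomial `R` in `m` variables of total degree at most `N`, the polynomial
`(1 - x₁)^N R(x₂ / (1 - x₁), …, x_{m+1} / (1 - x₁))` in `m + 1` variables
(see `eval_liftSimplex`). -/
def liftSimplex {m : ℕ} (N : ℕ) (R : MvPolynomial (Fin m) ℝ) : MvPolynomial (Fin (m + 1)) ℝ :=
  ∑ k ∈ Finset.range (N + 1),
    (1 - X 0) ^ (N - k) * rename Fin.succ (homogeneousComponent k R)

/-- The Jacobi polynomials `P_η^γ` on the `d`-dimensional simplex, `γ = (γ₁, …, γ_{d+1})`,
`η = (η₁, …, η_d)`. They are given recursively by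
`P_η^γ(x) = p_{η₁}^{a₁,b₁}(z₁) (1 - z₁)^{η₂+⋯+η_d} P_{η₂,…,η_d}^{γ₂,…,γ_{d+1}}(z₂, …, z_d)` with
`a₁ = 2(η₂+⋯+η_d) + (γ₂+⋯+γ_{d+1}) + d - 1`, `b₁ = γ₁`, `z₁ = x₁`, `z_j = x_j / (1 - x₁)`
(see `eval_simplexJacobi_succ`). -/
def simplexJacobi : (d : ℕ) → (Fin (d + 1) → ℝ) → (Fin d → ℕ) → MvPolynomial (Fin d) ℝ
  | 0, _, _ => 1
  | m + 1, γ, η =>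
    Polynomial.aeval (X 0)
        (jacobi (2 * ((∑ i : Fin m, η i.succ : ℕ) : ℝ) + (∑ i : Fin (m + 1), γ i.succ) + (m : ℝ))
          (γ 0) (η 0)) *
      liftSimplex (∑ i : Fin m, η i.succ)
        (simplexJacobi m (fun i => γ i.succ) (fun i => η i.succ))

/-- In dimension `d = m + 1`, with `γ₁ = 1`, the polynomials
`Q_η^γ(x) = q̂_{η₁,s}^{α,1;a₀}(z₁) (1 - z₁)^s P_{η₂,…,η_d}^{γ₂,…,γ_{d+1}}(z₂, …, z_d)` with
`s = η₂+⋯+η_d`, `α = γ₂+⋯+γ_{d+1} + d - 1`, `z₁ = x₁`, `z_j = x_j / (1 - x₁)`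
(see `eval_krallQ`). -/
def krallQ {m : ℕ} (γ : Fin (m + 2) → ℝ) (a₀ : ℝ) (η : Fin (m + 1) → ℕ) :
    MvPolynomial (Fin (m + 1)) ℝ :=
  Polynomial.aeval (X 0)
      (qhat ((∑ i : Fin (m + 1), γ i.succ) + (m : ℝ)) a₀ (η 0) (∑ i : Fin m, η i.succ)) *
    liftSimplex (∑ i : Fin m, η i.succ)
      (simplexJacobi m (fun i => γ i.succ) (fun i => η i.succ))

/-- The partial differential operator `M_{2,d}^γ` acting on polynomials in `d = m + 1` variables:
`∑_{k=2}^d (1 - x₁ - x_k) x_k ∂_k² - 2 ∑_{2≤k<l≤d} x_k x_l ∂_k ∂_l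
  + ∑_{k=2}^d [(γ_k + 1) (1 - x₁) - (γ₂+⋯+γ_{d+1} + d) x_k] ∂_k`.
The variables `x₂, …, x_d` are `X i.succ` for `i : Fin m`. -/
def opM2 {m : ℕ} (γ : Fin (m + 2) → ℝ) (f : MvPolynomial (Fin (m + 1)) ℝ) :
    MvPolynomial (Fin (m + 1)) ℝ :=
  (∑ i : Fin m, (1 - X 0 - X i.succ) * X i.succ * pderiv i.succ (pderiv i.succ f))
    - 2 * (∑ i : Fin m, ∑ j ∈ Finset.Ioi i,
        X i.succ * X j.succ * pderiv i.succ (pderiv j.succ f))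
    + ∑ i : Fin m, (C (γ i.succ.castSucc + 1) * (1 - X 0)
        - C ((∑ j : Fin (m + 1), γ j.succ) + ((m : ℝ) + 1)) * X i.succ) * pderiv i.succ f

/-- The simplex `{x ∈ ℝ^d : x_i ≥ 0, x₁ + ⋯ + x_d ≤ 1}`. -/
def simplex (d : ℕ) : Set (Fin d → ℝ) := {x | (∀ i, 0 ≤ x i) ∧ ∑ i, x i ≤ 1}

/-- The weight `x₂^{γ₂} ⋯ x_d^{γ_d} (1 - |x|)^{γ_{d+1}}`, where `d = m + 1`. -/
def weight {m : ℕ} (γ : Fin (m + 2) → ℝ) (x : Fin (m + 1) → ℝ) : ℝ :=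
  (∏ i : Fin m, x i.succ ^ γ i.succ.castSucc) * (1 - ∑ i, x i) ^ γ (Fin.last (m + 1))

/-- The Sobolev bilinear form, in dimension `d = m + 1`. In the second integral
`Fin.cons 0 y = (0, y₁, …, y_{d-1})`, so that `weight γ (Fin.cons 0 y)` is
`y₁^{γ₂} ⋯ y_{d-1}^{γ_d} (1 - |y|)^{γ_{d+1}}`. -/
def sobolevForm {m : ℕ} (γ : Fin (m + 2) → ℝ) (a₀ : ℝ) (f g : MvPolynomial (Fin (m + 1)) ℝ) : ℝ :=
  (∫ x in simplex (m + 1), eval x f * eval x g * weight γ x)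
    + 1 / (a₀ * ((∑ i : Fin (m + 1), γ i.succ) + ((m : ℝ) + 1))) *
        (∫ y in simplex m, eval (Fin.cons 0 y : Fin (m + 1) → ℝ) f *
          eval (Fin.cons 0 y : Fin (m + 1) → ℝ) g * weight γ (Fin.cons 0 y))
    - 1 / (a₀ * ((∑ i : Fin (m + 1), γ i.succ) + ((m : ℝ) + 1))) *
        (∫ x in simplex (m + 1), eval x (opM2 γ f) * eval x g * weight γ x)

theorem eval_liftSimplex {m : ℕ} (N : ℕ) (R : MvPolynomial (Fin m) ℝ) (hR : R.totalDegree ≤ N)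
    (x : Fin (m + 1) → ℝ) (hx : x 0 ≠ 1) :
    eval x (liftSimplex N R) = (1 - x 0) ^ N * eval (fun i => x i.succ / (1 - x 0)) R := by
  have h1 : (1 - x 0) ≠ 0 := sub_ne_zero.mpr (Ne.symm hx)
  have hsum : R = ∑ k ∈ Finset.range (N + 1), homogeneousComponent k R := by
    conv_lhs => rw [← sum_homogeneousComponent R]
    refine Finset.sum_subset ?_ ?_
    · intro k hk
      simp only [Finset.mem_range] at hk ⊢
      omega
    · intro k _ hk
      simp only [Finset.mem_range] at hk
      exact homogeneousComponent_eq_zero _ _ (by omega)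
  have key : ∀ k : ℕ, eval (fun i => x i.succ) (homogeneousComponent k R)
      = (1 - x 0) ^ k * eval (fun i => x i.succ / (1 - x 0)) (homogeneousComponent k R) := by
    intro k
    have hk := homogeneousComponent_isHomogeneous k R
    rw [eval_eq, eval_eq, Finset.mul_sum]
    refine Finset.sum_congr rfl ?_
    intro μ hμ
    have hdeg : ∑ i, μ i = k := by
      have := hk (mem_support_iff.mp hμ)
      rw [← this, Finsupp.weight_apply, Finsupp.sum_fintype] <;> simp
    simp only [div_pow]
    have h2 : ∏ i ∈ μ.support, (1 - x 0) ^ μ i = (1 - x 0) ^ k := by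
      rw [Finset.prod_pow_eq_pow_sum, ← hdeg]
      congr 1
      exact Finset.sum_subset (Finset.subset_univ _) (by
        intro i _ hi
        simpa using hi)
    rw [Finset.prod_div_distrib, h2]
    field_simp
  conv_rhs => rw [hsum]
  rw [liftSimplex, map_sum, map_sum, Finset.mul_sum]
  refine Finset.sum_congr rfl ?_
  intro k hk
  have hkN : k ≤ N := by
    simp only [Finset.mem_range] at hk
    omega
  simp only [map_mul, map_pow, map_sub, map_one, eval_X, eval_rename]
  have := key k
  simp only [Function.comp_def]
  rw [this, ← mul_assoc, ← pow_add, Nat.sub_add_cancel hkN]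

theorem totalDegree_liftSimplex_le {m : ℕ} (N : ℕ) (R : MvPolynomial (Fin m) ℝ) :
    (liftSimplex N R).totalDegree ≤ N := by
  refine totalDegree_finsetSum_le ?_
  intro k hk
  have hkN : k ≤ N := by
    simp only [Finset.mem_range] at hk
    omega
  refine (totalDegree_mul _ _).trans ?_
  have h1 : ((1 - X 0 : MvPolynomial (Fin (m + 1)) ℝ) ^ (N - k)).totalDegree ≤ N - k := by
    refine (totalDegree_pow _ _).trans ?_
    have : (1 - X 0 : MvPolynomial (Fin (m + 1)) ℝ).totalDegree ≤ 1 := by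
      refine (totalDegree_sub _ _).trans ?_
      simp
    calc (N - k) * _ ≤ (N - k) * 1 := Nat.mul_le_mul_left _ this
      _ = N - k := mul_one _
  have h2 : (rename Fin.succ (homogeneousComponent k R) :
      MvPolynomial (Fin (m + 1)) ℝ).totalDegree ≤ k :=
    (totalDegree_rename_le _ _).trans (homogeneousComponent_isHomogeneous k R).totalDegree_le
  omega

theorem natDegree_jacobi_le (α β : ℝ) (n : ℕ) : (jacobi α β n).natDegree ≤ n := by
  refine (Polynomial.natDegree_C_mul_le _ _).trans ?_
  refine Polynomial.natDegree_sum_le_of_forall_le _ _ ?_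
  intro k hk
  refine (Polynomial.natDegree_C_mul_X_pow_le _ _).trans ?_
  simp only [Finset.mem_range] at hk
  omega

theorem totalDegree_aeval_X_le {m : ℕ} (p : Polynomial ℝ) :
    (Polynomial.aeval (X 0 : MvPolynomial (Fin (m + 1)) ℝ) p).totalDegree ≤ p.natDegree := by
  rw [Polynomial.aeval_eq_sum_range]
  refine totalDegree_finsetSum_le ?_
  intro k hk
  refine (totalDegree_smul_le _ _).trans ((totalDegree_pow _ _).trans ?_)
  simp only [Finset.mem_range] at hk
  simp only [totalDegree_X]
  omega

theorem totalDegree_simplexJacobi_le (d : ℕ) (γ : Fin (d + 1) → ℝ) (η : Fin d → ℕ) :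
    (simplexJacobi d γ η).totalDegree ≤ ∑ i, η i := by
  cases d with
  | zero => simp [simplexJacobi]
  | succ m =>
    have h : ∑ i, η i = η 0 + ∑ i : Fin m, η i.succ := Fin.sum_univ_succ η
    rw [simplexJacobi, h]
    refine (totalDegree_mul _ _).trans (add_le_add ?_ (totalDegree_liftSimplex_le _ _))
    exact (totalDegree_aeval_X_le _).trans (natDegree_jacobi_le _ _ _)

theorem eval_aeval_X {m : ℕ} (p : Polynomial ℝ) (x : Fin (m + 1) → ℝ) :
    eval x (Polynomial.aeval (X 0 : MvPolynomial (Fin (m + 1)) ℝ) p) = p.eval (x 0) := by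
  have h : (eval x).comp (algebraMap ℝ (MvPolynomial (Fin (m + 1)) ℝ)) = RingHom.id ℝ := by
    ext r
    simp [MvPolynomial.algebraMap_eq]
  rw [Polynomial.aeval_def, Polynomial.hom_eval₂, h, eval_X, Polynomial.eval₂_id]

/-- The recursion that defines the Jacobi polynomials on the simplex. -/
theorem eval_simplexJacobi_succ {m : ℕ} (γ : Fin (m + 2) → ℝ) (η : Fin (m + 1) → ℕ)
    (x : Fin (m + 1) → ℝ) (hx : x 0 ≠ 1) :
    eval x (simplexJacobi (m + 1) γ η) =
      (jacobi (2 * ((∑ i : Fin m, η i.succ : ℕ) : ℝ) + (∑ i : Fin (m + 1), γ i.succ) + (m : ℝ))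
          (γ 0) (η 0)).eval (x 0) *
        ((1 - x 0) ^ (∑ i : Fin m, η i.succ) *
          eval (fun i => x i.succ / (1 - x 0))
            (simplexJacobi m (fun i => γ i.succ) (fun i => η i.succ))) := by
  rw [simplexJacobi, map_mul, eval_aeval_X,
    eval_liftSimplex _ _ (totalDegree_simplexJacobi_le _ _ _) x hx]

/-- The formula that defines the polynomials `Q_η^γ`. -/
theorem eval_krallQ {m : ℕ} (γ : Fin (m + 2) → ℝ) (a₀ : ℝ) (η : Fin (m + 1) → ℕ)
    (x : Fin (m + 1) → ℝ) (hx : x 0 ≠ 1) :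
    eval x (krallQ γ a₀ η) =
      (qhat ((∑ i : Fin (m + 1), γ i.succ) + (m : ℝ)) a₀ (η 0)
          (∑ i : Fin m, η i.succ)).eval (x 0) *
        ((1 - x 0) ^ (∑ i : Fin m, η i.succ) *
          eval (fun i => x i.succ / (1 - x 0))
            (simplexJacobi m (fun i => γ i.succ) (fun i => η i.succ))) := by
  rw [krallQ, map_mul, eval_aeval_X,
    eval_liftSimplex _ _ (totalDegree_simplexJacobi_le _ _ _) x hx]

end SimplexKrall

end

/-! Everything separates in the coordinates `x = (t, (1 - t) y)`. Write `c = 1 / (a₀ (α + 1))`; note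
that `|γ²| + d = α + 1`.

The operator `opM2` differentiates only in `x₂, …, x_d`, so functions of `x₁` pass through it. The
factor `(1 - x₁)^s P(x₂ / (1 - x₁), …)` is an eigenfunction with eigenvalue `-s (s + α)`
(`opM2_liftSimplex`), by the second-order equation of the Jacobi polynomials on the simplex, proved
by induction on the dimension (`isSimplexEigen_simplexJacobi`). Hence the third integral is a
multiple of the first. The change of variables `dirichletMeasure_eq_map` then turns the whole form
into a one-variable form in the `q̂` times the Dirichlet inner product of the two simplex
polynomials in `y` (`sobolevForm_krallQ`).

If the tails of `η` and `ξ` differ, the second factor vanishes (`integral_simplexJacobi_mul`). If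
they agree, `s` is common and the first factor is `(1 + c s (s + α)) ∫ q̂_n q̂_n' (1 - t)^(α + 2 s)
dt + c q̂_n(0) q̂_n'(0)`. With `B = (α + 1) a₀ + s (s + α)` the coefficient of the integral is `c
B`, and `B` is also the constant that appears in `q̂` once `ψ` is rewritten with parameter `α + 2
s`. What remains is the orthogonality of Krall-type polynomials for `B (1 - t)^a dt` plus a unit
mass at `0` (`krallAux_orthogonal`). -/

noncomputable section

namespace SimplexKrall

/-! ### Euler and Laplace-type operators, and homogenization in `1 - x₁`. -/

section

open MvPolynomial

/-- The Euler derivation `∑ x_i ∂_i` in the variables selected by `e`. -/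
def eulerOn {ι σ : Type*} [Fintype ι] (e : ι → σ) :
    Derivation ℝ (MvPolynomial σ ℝ) (MvPolynomial σ ℝ) :=
  ∑ i, (X (e i) : MvPolynomial σ ℝ) • pderiv (e i)

/-- The operator `∑ x_i ∂_i² + (β_i + 1) ∂_i` in the variables selected by `e`. -/
def laplOn {ι σ : Type*} [Fintype ι] (e : ι → σ) (β : ι → ℝ) (f : MvPolynomial σ ℝ) :
    MvPolynomial σ ℝ :=
  ∑ i, (X (e i) * pderiv (e i) (pderiv (e i) f) + C (β i + 1) * pderiv (e i) f)

section

variable {ι σ : Type*} [Fintype ι] (e : ι → σ) (β : ι → ℝ)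

theorem eulerOn_apply (f : MvPolynomial σ ℝ) :
    eulerOn e f = ∑ i, X (e i) * pderiv (e i) f := by
  rw [eulerOn, ← Derivation.coeFnAddMonoidHom_apply, map_sum, Finset.sum_apply]
  rfl

theorem laplOn_sum {κ : Type*} (s : Finset κ) (F : κ → MvPolynomial σ ℝ) :
    laplOn e β (∑ k ∈ s, F k) = ∑ k ∈ s, laplOn e β (F k) := by
  simp only [laplOn, map_sum, Finset.mul_sum, ← Finset.sum_add_distrib]
  exact Finset.sum_comm

theorem eulerOn_mul_left {g : MvPolynomial σ ℝ} (hg : ∀ i, pderiv (e i) g = 0)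
    (f : MvPolynomial σ ℝ) : eulerOn e (g * f) = g * eulerOn e f := by
  rw [eulerOn_apply, eulerOn_apply, Finset.mul_sum]
  refine Finset.sum_congr rfl fun i _ => ?_
  rw [pderiv_mul, hg]
  ring

theorem laplOn_mul_left {g : MvPolynomial σ ℝ} (hg : ∀ i, pderiv (e i) g = 0)
    (f : MvPolynomial σ ℝ) : laplOn e β (g * f) = g * laplOn e β f := by
  rw [laplOn, laplOn, Finset.mul_sum]
  refine Finset.sum_congr rfl fun i _ => ?_
  have h : ∀ f, pderiv (e i) (g * f) = g * pderiv (e i) f := fun f => by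
    rw [pderiv_mul, hg]
    ring
  rw [h, h]
  ring

theorem eulerOn_rename (he : Function.Injective e) (R : MvPolynomial ι ℝ) :
    eulerOn e (rename e R) = rename e (eulerOn id R) := by
  simp [eulerOn_apply, pderiv_rename he]

theorem laplOn_rename (he : Function.Injective e) (R : MvPolynomial ι ℝ) :
    laplOn e β (rename e R) = rename e (laplOn id β R) := by
  simp [laplOn, pderiv_rename he]

theorem eulerOn_of_isHomogeneous {R : MvPolynomial ι ℝ} {k : ℕ} (hR : R.IsHomogeneous k) :
    eulerOn id R = C (k : ℝ) * R := by
  rw [eulerOn_apply]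
  simpa using hR.sum_X_mul_pderiv

theorem laplOn_isHomogeneous {R : MvPolynomial ι ℝ} {k : ℕ} (hR : R.IsHomogeneous (k + 1)) :
    (laplOn id β R).IsHomogeneous k := by
  refine IsHomogeneous.sum _ _ _ fun i _ => IsHomogeneous.add ?_ ?_
  -- A linear form has constant first derivatives, so its second-order terms vanish; only from
  -- degree two on does `k - 1` make sense as their degree.
  · rcases k with _ | k
    · have h : (pderiv i R).IsHomogeneous 0 := hR.pderiv
      obtain ⟨c, hc⟩ : ∃ c, pderiv i R = C c :=
        ⟨_, totalDegree_eq_zero_iff_eq_C.mp (Nat.le_zero.mp h.totalDegree_le)⟩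
      simp only [id, hc, pderiv_C, mul_zero]
      exact isHomogeneous_zero _ _ _
    · have h : (pderiv i (pderiv i R)).IsHomogeneous k := (hR.pderiv (i := i)).pderiv
      have := (isHomogeneous_X ℝ i).mul h
      rwa [add_comm] at this
  · have h : (pderiv i R).IsHomogeneous k := hR.pderiv
    simpa using (isHomogeneous_C ι (β i + 1)).mul h

end

theorem sum_sum_eq_diag_add {A : Type*} [CommRing A] {m : ℕ} (a : Fin m → Fin m → A)
    (ha : ∀ i j, a i j = a j i) :
    ∑ i, ∑ j, a i j = ∑ i, a i i + 2 * ∑ i, ∑ j ∈ Finset.Ioi i, a i j := by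
  have h := Finset.sum_sum_Ioi_add_eq_sum_sum_off_diag a
  have h2 : ∀ i, ∑ j, a i j = a i i + ∑ j ∈ {i}ᶜ, a j i := fun i => by
    rw [Fintype.sum_eq_add_sum_compl i]
    simp only [ha i]
  rw [Finset.sum_congr rfl fun i _ => h2 i, Finset.sum_add_distrib, ← h, Finset.mul_sum]
  congr 1
  refine Finset.sum_congr rfl fun i _ => ?_
  rw [Finset.mul_sum]
  refine Finset.sum_congr rfl fun j _ => ?_
  rw [ha j i]
  ring

theorem eulerOn_eulerOn {m : ℕ} {σ : Type*} (e : Fin m → σ) (he : Function.Injective e)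
    (f : MvPolynomial σ ℝ) :
    eulerOn e (eulerOn e f) =
      ∑ i, ∑ j, X (e i) * X (e j) * pderiv (e i) (pderiv (e j) f) + eulerOn e f := by
  classical
  rw [eulerOn_apply e (eulerOn e f), eulerOn_apply e f, ← Finset.sum_add_distrib]
  refine Finset.sum_congr rfl fun i _ => ?_
  rw [map_sum, Finset.mul_sum]
  have h : ∀ j, X (e i) * pderiv (e i) (X (e j) * pderiv (e j) f) =
      X (e i) * X (e j) * pderiv (e i) (pderiv (e j) f) +
        if j = i then X (e i) * pderiv (e i) f else 0 := by
    intro j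
    rw [pderiv_mul, pderiv_X]
    by_cases hj : j = i
    · subst hj
      simp
      ring
    · rw [Pi.single_eq_of_ne (fun h => hj (he h)), if_neg hj]
      ring
  rw [Finset.sum_congr rfl fun j _ => h j, Finset.sum_add_distrib]
  simp

/-- The commutator of two derivations is a derivation, and this one kills every variable. -/
theorem pderiv_comm {σ : Type*} (i j : σ) (f : MvPolynomial σ ℝ) :
    pderiv i (pderiv j f) = pderiv j (pderiv i f) := by
  classical
  have h : ⁅(pderiv i : Derivation ℝ (MvPolynomial σ ℝ) (MvPolynomial σ ℝ)),
      (pderiv j : Derivation ℝ (MvPolynomial σ ℝ) (MvPolynomial σ ℝ))⁆ = 0 := by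
    refine derivation_ext fun k => ?_
    rw [Derivation.commutator_apply, pderiv_X, pderiv_X]
    simp only [Pi.single_apply]
    split_ifs <;> simp
  have := congrArg (fun D => D f) h
  simpa [Derivation.commutator_apply, sub_eq_zero] using this

/-- The terms `-x_k² ∂_k²` and `-2 x_k x_l ∂_k ∂_l` add up to `-(E² - E)`. The extra `E` lowers the
first-order constant from `|γ²| + d` to `α = |γ²| + d - 1`. -/
theorem opM2_eq {m : ℕ} (γ : Fin (m + 2) → ℝ) (f : MvPolynomial (Fin (m + 1)) ℝ) :
    opM2 γ f = (1 - X 0) * laplOn Fin.succ (fun i => γ i.succ.castSucc) f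
      - eulerOn Fin.succ (eulerOn Fin.succ f)
      - C ((∑ j : Fin (m + 1), γ j.succ) + (m : ℝ)) * eulerOn Fin.succ f := by
  rw [eulerOn_eulerOn _ (Fin.succ_injective m), sum_sum_eq_diag_add _ (fun i j => by
    rw [pderiv_comm]; ring), opM2, laplOn, eulerOn_apply]
  simp only [Finset.mul_sum, ← Finset.sum_add_distrib, ← Finset.sum_sub_distrib]
  refine Finset.sum_congr rfl fun i _ => ?_
  simp only [C_add, C_1]
  ring

/-- `R` is annihilated by `∑ x_i ∂_i² + (β_i + 1) ∂_i - E (E + a) + N (N + a)`, with `E` the Euler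
derivation. -/
def IsSimplexEigen {m : ℕ} (β : Fin m → ℝ) (a : ℝ) (N : ℕ) (R : MvPolynomial (Fin m) ℝ) : Prop :=
  laplOn id β R - eulerOn id (eulerOn id R) - C a * eulerOn id R = - (C (N * (N + a)) * R)

theorem liftSimplex_sum {m : ℕ} (N : ℕ) {κ : Type*} (s : Finset κ)
    (F : κ → MvPolynomial (Fin m) ℝ) :
    liftSimplex N (∑ k ∈ s, F k) = ∑ k ∈ s, liftSimplex N (F k) := by
  simp only [liftSimplex, map_sum, Finset.mul_sum]
  exact Finset.sum_comm

theorem liftSimplex_C_mul {m : ℕ} (N : ℕ) (c : ℝ) (R : MvPolynomial (Fin m) ℝ) :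
    liftSimplex N (C c * R) = C c * liftSimplex N R := by
  simp only [liftSimplex, homogeneousComponent_C_mul, map_mul, rename_C, Finset.mul_sum]
  refine Finset.sum_congr rfl fun k _ => ?_
  ring

theorem liftSimplex_of_isHomogeneous {m N k : ℕ} {R : MvPolynomial (Fin m) ℝ}
    (hR : R.IsHomogeneous k) (hk : k ≤ N) :
    liftSimplex N R = (1 - X 0) ^ (N - k) * rename Fin.succ R := by
  rw [liftSimplex, Finset.sum_eq_single k]
  · rw [homogeneousComponent_of_mem ((mem_homogeneousSubmodule _ _).mpr hR), if_pos rfl]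
  · intro j _ hj
    rw [homogeneousComponent_of_mem ((mem_homogeneousSubmodule _ _).mpr hR), if_neg hj]
    simp
  · intro h
    simp at h
    omega

theorem sum_homogeneousComponent_of_le {m N : ℕ} {R : MvPolynomial (Fin m) ℝ}
    (hR : R.totalDegree ≤ N) :
    R = ∑ k ∈ Finset.range (N + 1), homogeneousComponent k R := by
  conv_lhs => rw [← sum_homogeneousComponent R]
  refine Finset.sum_subset (fun k hk => ?_) fun k _ hk => ?_
  · simp only [Finset.mem_range] at hk ⊢
    omega
  · simp only [Finset.mem_range] at hk
    exact homogeneousComponent_eq_zero _ _ (by omega)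

theorem pderiv_succ_one_sub_X_pow {m : ℕ} (i : Fin m) (j : ℕ) :
    pderiv i.succ ((1 - X 0 : MvPolynomial (Fin (m + 1)) ℝ) ^ j) = 0 := by
  simp [pderiv_X_of_ne (Fin.succ_ne_zero i).symm]

theorem pderiv_zero_rename {m : ℕ} (R : MvPolynomial (Fin m) ℝ) :
    pderiv 0 (rename Fin.succ R : MvPolynomial (Fin (m + 1)) ℝ) = 0 := by
  classical
  refine pderiv_eq_zero_of_notMem_vars fun h => ?_
  obtain ⟨i, _, hi⟩ := Finset.mem_image.mp (vars_rename _ _ h)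
  exact Fin.succ_ne_zero i hi

/-- Euler's identity: the lift is homogeneous of degree `N` in `1 - x₁` and the remaining variables
together. -/
theorem one_sub_X_mul_pderiv_liftSimplex {m N : ℕ} {R : MvPolynomial (Fin m) ℝ}
    (hR : R.totalDegree ≤ N) :
    (1 - X 0) * pderiv 0 (liftSimplex N R) =
      eulerOn Fin.succ (liftSimplex N R) - C (N : ℝ) * liftSimplex N R := by
  rw [sum_homogeneousComponent_of_le hR]
  simp only [liftSimplex_sum, map_sum, Finset.mul_sum, ← Finset.sum_sub_distrib]
  refine Finset.sum_congr rfl fun k hk => ?_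
  have hkN : k ≤ N := by simp at hk; omega
  have hh := homogeneousComponent_isHomogeneous k R
  rw [liftSimplex_of_isHomogeneous hh hkN, eulerOn_mul_left _ (pderiv_succ_one_sub_X_pow · _),
    eulerOn_rename _ (Fin.succ_injective m), eulerOn_of_isHomogeneous hh, pderiv_mul,
    pderiv_zero_rename, pderiv_pow]
  obtain ⟨j, rfl⟩ := Nat.exists_eq_add_of_le hkN
  rcases j with _ | j
  · simp
  · simp [pow_succ]
    ring

/-- Lifting intertwines the operator of `IsSimplexEigen` with `opM2`. It suffices to check one
homogeneous component: `E` keeps the degree, while the Laplace part lowers it by one, which the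
factor `1 - x₁` in `opM2` makes up for. -/
theorem opM2_liftSimplex {m N : ℕ} (γ : Fin (m + 2) → ℝ) {R : MvPolynomial (Fin m) ℝ}
    (hR : R.totalDegree ≤ N)
    (hE : IsSimplexEigen (fun i => γ i.succ.castSucc) ((∑ j : Fin (m + 1), γ j.succ) + m) N R) :
    opM2 γ (liftSimplex N R) =
      - (C (N * (N + ((∑ j : Fin (m + 1), γ j.succ) + m))) * liftSimplex N R) := by
  set a := (∑ j : Fin (m + 1), γ j.succ) + (m : ℝ)
  set β := fun i : Fin m => γ i.succ.castSucc
  have key : opM2 γ (liftSimplex N R) =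
      liftSimplex N (laplOn id β R - eulerOn id (eulerOn id R) - C a * eulerOn id R) := by
    have hsub : ∀ A B D : MvPolynomial (Fin m) ℝ, liftSimplex N (A - B - D) =
        liftSimplex N A - liftSimplex N B - liftSimplex N D := fun A B D => by
      simp only [liftSimplex, map_sub, mul_sub, Finset.sum_sub_distrib]
    rw [opM2_eq, hsub, sum_homogeneousComponent_of_le hR]
    simp only [liftSimplex_sum, laplOn_sum, map_sum, Finset.mul_sum, ← Finset.sum_sub_distrib]
    refine Finset.sum_congr rfl fun k hk => ?_
    have hkN : k ≤ N := by simp at hk; omega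
    have hh := homogeneousComponent_isHomogeneous k R
    set S := homogeneousComponent k R
    have h1 : eulerOn Fin.succ (liftSimplex N S) = C (k : ℝ) * liftSimplex N S := by
      rw [liftSimplex_of_isHomogeneous hh hkN, eulerOn_mul_left _ (pderiv_succ_one_sub_X_pow · _),
        eulerOn_rename _ (Fin.succ_injective m), eulerOn_of_isHomogeneous hh]
      simp
      ring
    have h2 : (1 - X 0) * laplOn Fin.succ β (liftSimplex N S) = liftSimplex N (laplOn id β S) := by
      rw [liftSimplex_of_isHomogeneous hh hkN, laplOn_mul_left _ _ (pderiv_succ_one_sub_X_pow · _),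
        laplOn_rename _ _ (Fin.succ_injective m)]
      rcases k with _ | k
      · have : S = C (coeff 0 S) := totalDegree_eq_zero_iff_eq_C.mp (Nat.le_zero.mp hh.totalDegree_le)
        have h0 : laplOn id β S = 0 := by rw [this]; simp [laplOn]
        rw [h0]
        simp [liftSimplex]
      · rw [liftSimplex_of_isHomogeneous (laplOn_isHomogeneous β hh) (by omega),
          show N - k = (N - (k + 1)) + 1 by omega]
        ring
    have hC : ∀ f, eulerOn (Fin.succ : Fin m → _) (C (k : ℝ) * f) = C (k : ℝ) * eulerOn Fin.succ f :=
      fun f => eulerOn_mul_left _ (fun _ => pderiv_C) f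
    have hC' : eulerOn id (C (k : ℝ) * S) = C (k : ℝ) * eulerOn id S :=
      eulerOn_mul_left _ (fun _ => pderiv_C) S
    rw [h1, h2, hC, h1, eulerOn_of_isHomogeneous hh, hC', eulerOn_of_isHomogeneous hh]
    simp only [liftSimplex_C_mul, a]
  rw [key, hE, ← neg_mul, ← C_neg, liftSimplex_C_mul, C_neg, neg_mul]

end

/-! ### The hypergeometric equation of the Jacobi polynomials. -/

section

theorem poch_succ (a : ℝ) (n : ℕ) : poch a (n + 1) = poch a n * (a + n) := by
  simp [poch, ascPochhammer_succ_eval]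

theorem poch_zero (a : ℝ) : poch a 0 = 1 := by simp [poch]

theorem poch_pos {a : ℝ} (ha : 0 < a) (n : ℕ) : 0 < poch a n := ascPochhammer_pos n a ha

theorem poch_neg_eq_zero {n k : ℕ} (h : n < k) : poch (-(n : ℝ)) k = 0 := by
  induction k, h using Nat.le_induction with
  | base => simp [poch_succ]
  | succ k _ ih => simp [poch_succ, ih]

section Poly
open Polynomial

/-- The formula needs no bound on `k`, since `(-n)_k = 0` beyond the degree. -/
theorem coeff_jacobi (α β : ℝ) (n k : ℕ) :
    (jacobi α β n).coeff k = (-1) ^ n * (poch (α + β + 1) n / (n.factorial : ℝ)) *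
      (poch (β + 1) n / poch (α + 1) n) * (poch (-(n : ℝ)) k * poch ((n : ℝ) + α + β + 1) k /
        ((k.factorial : ℝ) * poch (β + 1) k)) := by
  rw [jacobi, coeff_C_mul, finsetSum_coeff]
  congr 1
  simp only [coeff_C_mul, coeff_X_pow, mul_ite, mul_one, mul_zero, Finset.sum_ite_eq,
    Finset.mem_range]
  split_ifs with h
  · rfl
  · rw [poch_neg_eq_zero (by omega)]
    simp

/-- This is the hypergeometric equation read off coefficientwise. -/
theorem coeff_jacobi_succ {α β : ℝ} (hβ : -1 < β) (n k : ℕ) :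
    (k + 1) * (k + 1 + β) * (jacobi α β n).coeff (k + 1) =
      (k - n) * (k + n + α + β + 1) * (jacobi α β n).coeff k := by
  have h1 : poch (β + 1) k ≠ 0 := (poch_pos (by linarith) k).ne'
  have h2 : β + 1 + k ≠ 0 := by have := k.cast_nonneg (α := ℝ); linarith
  have h3 : (k.factorial : ℝ) ≠ 0 := by positivity
  have h4 : (k : ℝ) + 1 ≠ 0 := by positivity
  rw [coeff_jacobi, coeff_jacobi, poch_succ, poch_succ, poch_succ, Nat.factorial_succ]
  push_cast
  field_simp
  ring

/-- The hypergeometric differential operator of the Jacobi polynomials on `[0, 1]`. -/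
def jacobiOp (α β : ℝ) (f : ℝ[X]) : ℝ[X] :=
  X * (1 - X) * derivative (derivative f) + (C (β + 1) - C (α + β + 2) * X) * derivative f

theorem jacobiOp_jacobi {α β : ℝ} (hβ : -1 < β) (n : ℕ) :
    jacobiOp α β (jacobi α β n) = - (C (n * (n + α + β + 1)) * jacobi α β n) := by
  have hsplit : ∀ f : ℝ[X], jacobiOp α β f = X * derivative (derivative f)
      - X * (X * derivative (derivative f)) + C (β + 1) * derivative f
      - C (α + β + 2) * (X * derivative f) := fun f => by rw [jacobiOp]; ring
  rw [hsplit]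
  ext k
  have h := coeff_jacobi_succ (α := α) hβ n k
  rcases k with _ | _ | k
  · simp only [coeff_sub, coeff_add, coeff_neg, coeff_C_mul, coeff_X_mul_zero, coeff_derivative] at h ⊢
    push_cast at h ⊢
    linear_combination h
  · simp only [coeff_sub, coeff_add, coeff_neg, coeff_C_mul, coeff_X_mul, coeff_X_mul_zero,
      coeff_derivative] at h ⊢
    push_cast at h ⊢
    linear_combination h
  · simp only [coeff_sub, coeff_add, coeff_neg, coeff_C_mul, coeff_X_mul, coeff_derivative] at h ⊢
    push_cast at h ⊢
    linear_combination h

/-- Both Pochhammer quotients collapse: `(α + 2)_n / (α + 1)_n = (α + 1 + n) / (α + 1)` and `(2)_n /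
n! = n + 1`. Thus `ψ_n = (-1)^n a₀ + p_n^{α,1}(0)` for `n ≥ 0`. -/
theorem eval_zero_jacobi_one {α : ℝ} (hα : -1 < α) (n : ℕ) :
    (jacobi α 1 n).eval 0 = (-1) ^ n * ((n + 1) * (n + α + 1) / (α + 1)) := by
  have h1 : ∀ k : ℕ, poch (α + 1 + 1) k * (α + 1) = poch (α + 1) k * (α + 1 + k) := fun k => by
    induction k with
    | zero => simp [poch_zero]
    | succ k ih =>
      rw [poch_succ, poch_succ]
      push_cast
      linear_combination (α + 2 + k) * ih
  have h2 : ∀ k : ℕ, poch (1 + 1) k = (k + 1) * k.factorial := fun k => by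
    induction k with
    | zero => simp [poch_zero]
    | succ k ih =>
      rw [poch_succ, ih, Nat.factorial_succ]
      push_cast
      ring
  have h3 : poch (α + 1) n ≠ 0 := (poch_pos (by linarith) n).ne'
  have h4 : α + 1 ≠ 0 := by linarith
  have h5 : (n.factorial : ℝ) ≠ 0 := by positivity
  have h6 : poch (α + 1 + 1) n = poch (α + 1) n * (α + 1 + n) / (α + 1) := by
    rw [← h1 n]
    field_simp
  rw [← coeff_zero_eq_eval_zero, coeff_jacobi, h2, h6]
  simp only [poch_zero, Nat.factorial_zero]
  field_simp
  push_cast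
  ring

end Poly

/-! ### The differential equation of the Jacobi polynomials on the simplex. -/

open MvPolynomial

theorem pderiv_aeval_X {m : ℕ} (p : Polynomial ℝ) :
    pderiv 0 (Polynomial.aeval (X 0 : MvPolynomial (Fin (m + 1)) ℝ) p) =
      Polynomial.aeval (X 0) (Polynomial.derivative p) := by
  rw [Derivation.map_aeval]
  simp

theorem pderiv_succ_aeval_X {m : ℕ} (i : Fin m) (p : Polynomial ℝ) :
    pderiv i.succ (Polynomial.aeval (X 0 : MvPolynomial (Fin (m + 1)) ℝ) p) = 0 := by
  rw [Derivation.map_aeval, pderiv_X_of_ne (Fin.succ_ne_zero i).symm, smul_zero]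

theorem opM2_aeval_mul {m : ℕ} (γ : Fin (m + 2) → ℝ) (p : Polynomial ℝ)
    (h : MvPolynomial (Fin (m + 1)) ℝ) :
    opM2 γ (Polynomial.aeval (X 0) p * h) = Polynomial.aeval (X 0) p * opM2 γ h := by
  simp only [opM2_eq, laplOn_mul_left _ _ (pderiv_succ_aeval_X · p),
    eulerOn_mul_left _ (pderiv_succ_aeval_X · p)]
  ring

theorem one_sub_X_ne_zero {m : ℕ} : (1 - X 0 : MvPolynomial (Fin (m + 1)) ℝ) ≠ 0 := fun h => by
  have := congrArg (eval 0) h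
  simp at this

/-- Separation of variables for `p(x₁) h`, with `h` the lift of `R`. The ingredients are the Jacobi
equation of `p`, the eigenvalue equation of `h` in the other variables, and Euler's identity, which
trades `∂₁ h` for `E h`. The eigenvalues combine as `n (n + 2 N + c) + N (N + c) = (n + N) (n + N +
c)` with `c = a + δ 0 + 1`. -/
theorem isSimplexEigen_aeval_mul_liftSimplex {m N n : ℕ} {δ : Fin (m + 2) → ℝ} (hδ : -1 < δ 0)
    {R : MvPolynomial (Fin m) ℝ} (hR : R.totalDegree ≤ N)
    (hE : IsSimplexEigen (fun i => δ i.succ.castSucc) ((∑ j : Fin (m + 1), δ j.succ) + m) N R) :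
    IsSimplexEigen (fun i : Fin (m + 1) => δ i.castSucc) ((∑ j, δ j) + ((m + 1 : ℕ) : ℝ)) (n + N)
      (Polynomial.aeval (X 0)
        (jacobi (2 * N + (∑ j : Fin (m + 1), δ j.succ) + m) (δ 0) n) * liftSimplex N R) := by
  set a := (∑ j : Fin (m + 1), δ j.succ) + (m : ℝ) with ha
  have hα : (∑ j, δ j) + ((m + 1 : ℕ) : ℝ) = a + δ 0 + 1 := by
    rw [Fin.sum_univ_succ, ha]
    push_cast
    ring
  have hα2 : 2 * N + (∑ j : Fin (m + 1), δ j.succ) + m = 2 * N + a := by rw [ha]; ring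
  rw [hα, hα2]
  set q := jacobi (2 * N + a) (δ 0) n
  set h := liftSimplex N R
  set p : MvPolynomial (Fin (m + 1)) ℝ := Polynomial.aeval (X 0) q with hp
  set p' : MvPolynomial (Fin (m + 1)) ℝ := Polynomial.aeval (X 0) (Polynomial.derivative q) with hp'
  set p'' : MvPolynomial (Fin (m + 1)) ℝ :=
    Polynomial.aeval (X 0) (Polynomial.derivative (Polynomial.derivative q))
  set L := laplOn Fin.succ (fun i => δ i.succ.castSucc) h with hL
  set A := eulerOn Fin.succ h with hA
  set B := eulerOn Fin.succ A with hB
  have ode : X 0 * (1 - X 0) * p'' + (C (δ 0 + 1) - C (2 * N + a + δ 0 + 2) * X 0) * p' =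
      - (C (n * (n + (2 * N + a) + δ 0 + 1)) * p) := by
    simpa [jacobiOp, MvPolynomial.algebraMap_eq] using
      congrArg (Polynomial.aeval (X 0 : MvPolynomial (Fin (m + 1)) ℝ))
        (jacobiOp_jacobi (α := 2 * N + a) hδ n)
  have h1 : (1 - X 0) * L - B - C a * A = - (C (N * (N + a)) * h) := by
    rw [← opM2_liftSimplex δ hR hE, opM2_eq]
  have h2 : (1 - X 0) * pderiv 0 h = A - C (N : ℝ) * h :=
    one_sub_X_mul_pderiv_liftSimplex hR
  -- Here `h3` comes from applying `∂₁` to `h2`, and `h4` from applying `E`.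
  have h3 : (1 - X 0) * pderiv 0 (pderiv 0 h) - pderiv 0 h = pderiv 0 A - C (N : ℝ) * pderiv 0 h := by
    have := congrArg (pderiv 0) h2
    simp only [pderiv_mul, map_sub, pderiv_one, pderiv_X_self, pderiv_C] at this
    linear_combination this
  have h4 : (1 - X 0) * pderiv 0 A = B - C (N : ℝ) * A := by
    have := congrArg (eulerOn Fin.succ) h2
    rw [eulerOn_mul_left _ (fun i => by simp [pderiv_X_of_ne (Fin.succ_ne_zero i).symm]), map_sub,
      eulerOn_mul_left _ (fun i => pderiv_C)] at this
    rw [← this, hA, eulerOn_apply, eulerOn_apply, map_sum]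
    congr 1
    refine Finset.sum_congr rfl fun i _ => ?_
    rw [pderiv_mul, pderiv_X_of_ne (Fin.succ_ne_zero i), pderiv_comm]
    ring
  have e0 : pderiv 0 (p * h) = p' * h + p * pderiv 0 h := by
    rw [pderiv_mul, hp, pderiv_aeval_X]
  have e1 : pderiv 0 (p' * h + p * pderiv 0 h) =
      p'' * h + 2 * p' * pderiv 0 h + p * pderiv 0 (pderiv 0 h) := by
    rw [map_add, pderiv_mul, pderiv_mul, hp, hp', pderiv_aeval_X, pderiv_aeval_X]
    ring
  have e2 : ∀ f, eulerOn id f = X 0 * pderiv 0 f + eulerOn (Fin.succ : Fin m → _) f := fun f => by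
    rw [eulerOn_apply, eulerOn_apply, Fin.sum_univ_succ]
    rfl
  have e3 : laplOn id (fun i : Fin (m + 1) => δ i.castSucc) (p * h) =
      X 0 * pderiv 0 (pderiv 0 (p * h)) + C (δ 0 + 1) * pderiv 0 (p * h) + p * L := by
    rw [hL, ← laplOn_mul_left _ _ (pderiv_succ_aeval_X · q), laplOn, laplOn, Fin.sum_univ_succ]
    rfl
  have e4 : ∀ f, eulerOn Fin.succ (p * f) = p * eulerOn Fin.succ f :=
    eulerOn_mul_left _ (pderiv_succ_aeval_X · q)
  have e5 : eulerOn Fin.succ (X 0 * (p' * h + p * pderiv 0 h)) =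
      X 0 * (p' * A + p * pderiv 0 A) := by
    have : ∀ f, pderiv 0 (eulerOn (Fin.succ : Fin m → _) f) = eulerOn Fin.succ (pderiv 0 f) := by
      intro f
      rw [eulerOn_apply, eulerOn_apply, map_sum]
      refine Finset.sum_congr rfl fun i _ => ?_
      rw [pderiv_mul, pderiv_X_of_ne (Fin.succ_ne_zero i), pderiv_comm]
      ring
    rw [eulerOn_mul_left _ (fun i => pderiv_X_of_ne (Fin.succ_ne_zero i).symm), map_add, e4,
      eulerOn_mul_left _ (pderiv_succ_aeval_X · _), hA, this]
  have e6 : pderiv 0 (X 0 * (p' * h + p * pderiv 0 h) + p * A) = (p' * h + p * pderiv 0 h) +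
      X 0 * (p'' * h + 2 * p' * pderiv 0 h + p * pderiv 0 (pderiv 0 h))
        + p' * A + p * pderiv 0 A := by
    rw [map_add, pderiv_mul, pderiv_X_self, e1, pderiv_mul, hp, pderiv_aeval_X]
    ring
  rw [IsSimplexEigen, e3, e2 (p * h), e0, e4, e2, e6, e1, map_add (eulerOn Fin.succ), e5, e4, ← hA, ← hB]
  -- Only `(1 - x₁) ∂₁ h` is known polynomially, so the identity is proved after multiplication by
  -- `1 - x₁`.
  refine mul_left_cancel₀ one_sub_X_ne_zero ?_
  simp only [C_add, C_mul, C_1, Nat.cast_add] at ode h1 h2 h3 h4 ⊢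
  have hC2 : (C 2 : MvPolynomial (Fin (m + 1)) ℝ) = 2 := map_ofNat _ 2
  simp only [hC2] at ode h1 h2 h3 h4 ⊢
  linear_combination (1 - X 0) * h * ode + p * h1 + X 0 * (1 - X 0) * p * h3 - X 0 * p * h4
    + (2 * X 0 * (1 - X 0) * p' + p * (C (δ 0) + 1 - (C a + C (δ 0) + 1) * X 0 - C (N : ℝ) * X 0)) * h2

theorem isSimplexEigen_simplexJacobi (m : ℕ) (δ : Fin (m + 1) → ℝ) (hδ : ∀ i, -1 < δ i)
    (η : Fin m → ℕ) :
    IsSimplexEigen (fun i => δ i.castSucc) ((∑ j, δ j) + m) (∑ i, η i) (simplexJacobi m δ η) := by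
  induction m with
  | zero => simp [IsSimplexEigen, simplexJacobi, laplOn, eulerOn_apply]
  | succ m ih =>
    rw [simplexJacobi, Fin.sum_univ_succ η]
    exact isSimplexEigen_aeval_mul_liftSimplex (hδ 0) (totalDegree_simplexJacobi_le _ _ _)
      (ih _ (fun i => hδ i.succ) _)

end

/-! ### The one-variable Jacobi weight and its orthogonal polynomials. -/

section

theorem integrable_of_continuous_of_ae_mem {Y : Type*} [TopologicalSpace Y] [T2Space Y]
    [MeasurableSpace Y] [OpensMeasurableSpace Y] {μ : Measure Y} [IsFiniteMeasure μ] {K : Set Y}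
    (hK : IsCompact K) (hμ : ∀ᵐ x ∂μ, x ∈ K) {f : Y → ℝ} (hf : Continuous f) :
    Integrable f μ := by
  have h := hf.continuousOn.integrableOn_compact (μ := μ) hK
  rwa [IntegrableOn, Measure.restrict_eq_self_of_ae_mem hμ] at h

/-- The measure `t^b (1 - t)^a dt` on `(0, 1)`. -/
def jacobiMeasure (a b : ℝ) : Measure ℝ :=
  (volume.restrict (Set.Ioo 0 1)).withDensity fun t => ENNReal.ofReal (t ^ b * (1 - t) ^ a)

theorem measurable_jacobiDensity (a b : ℝ) :
    Measurable fun t : ℝ => ENNReal.ofReal (t ^ b * (1 - t) ^ a) := by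
  fun_prop

/-- The density is a Beta function value times the density of a Beta distribution. -/
theorem isFiniteMeasure_jacobiMeasure {a b : ℝ} (ha : -1 < a) (hb : -1 < b) :
    IsFiniteMeasure (jacobiMeasure a b) := by
  refine ⟨?_⟩
  have hα : 0 < b + 1 := by linarith
  have hβ : 0 < a + 1 := by linarith
  have hB := ProbabilityTheory.beta_pos hα hβ
  have h1 : jacobiMeasure a b Set.univ =
      ENNReal.ofReal (ProbabilityTheory.beta (b + 1) (a + 1)) *
        ∫⁻ t, ProbabilityTheory.betaPDF (b + 1) (a + 1) t := by
    rw [jacobiMeasure, withDensity_apply _ MeasurableSet.univ, Measure.restrict_univ,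
      ProbabilityTheory.lintegral_betaPDF, ← lintegral_const_mul _ (by fun_prop)]
    refine setLIntegral_congr_fun measurableSet_Ioo fun t ht => ?_
    rw [← ENNReal.ofReal_mul hB.le, add_sub_cancel_right, add_sub_cancel_right]
    congr 1
    field_simp
  rw [h1, ProbabilityTheory.lintegral_betaPDF_eq_one hα hβ, mul_one]
  exact ENNReal.ofReal_lt_top

theorem ae_mem_Ioo_jacobiMeasure (a b : ℝ) : ∀ᵐ t ∂jacobiMeasure a b, t ∈ Set.Ioo (0 : ℝ) 1 :=
  (withDensity_absolutelyContinuous _ _).ae_le (ae_restrict_mem measurableSet_Ioo)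

theorem integral_jacobiMeasure (a b : ℝ) (f : ℝ → ℝ) :
    ∫ t, f t ∂jacobiMeasure a b = ∫ t in Set.Ioo 0 1, t ^ b * (1 - t) ^ a * f t := by
  rw [jacobiMeasure, integral_withDensity_eq_integral_toReal_smul (measurable_jacobiDensity a b)
    (by simp)]
  refine setIntegral_congr_fun measurableSet_Ioo fun t ht => ?_
  rw [ENNReal.toReal_ofReal, smul_eq_mul]
  exact mul_nonneg (Real.rpow_nonneg ht.1.le _) (Real.rpow_nonneg (by linarith [ht.2]) _)

theorem integrable_jacobiMeasure {a b : ℝ} (ha : -1 < a) (hb : -1 < b) {f : ℝ → ℝ}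
    (hf : Continuous f) : Integrable f (jacobiMeasure a b) := by
  have := isFiniteMeasure_jacobiMeasure ha hb
  exact integrable_of_continuous_of_ae_mem isCompact_Icc
    ((ae_mem_Ioo_jacobiMeasure a b).mono fun t ht => Set.Ioo_subset_Icc_self ht) hf

theorem integrableOn_jacobiDensity_mul {a b : ℝ} (ha : -1 < a) (hb : -1 < b) {f : ℝ → ℝ}
    (hf : Continuous f) : IntegrableOn (fun t => t ^ b * (1 - t) ^ a * f t) (Set.Ioo 0 1) := by
  have h := integrable_jacobiMeasure ha hb hf
  rw [jacobiMeasure, integrable_withDensity_iff_integrable_smul' (measurable_jacobiDensity a b)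
    (by simp)] at h
  refine h.congr (ae_restrict_of_forall_mem measurableSet_Ioo fun t ht => ?_)
  simp only
  rw [ENNReal.toReal_ofReal, smul_eq_mul]
  exact mul_nonneg (Real.rpow_nonneg ht.1.le _) (Real.rpow_nonneg (by linarith [ht.2]) _)

open Polynomial

/-- The moment functional of `t^b (1 - t)^a dt` on `(0, 1)`. -/
def jacobiInt (a b : ℝ) (f : ℝ[X]) : ℝ := ∫ t, f.eval t ∂jacobiMeasure a b

theorem jacobiInt_add {a b : ℝ} (ha : -1 < a) (hb : -1 < b) (f g : ℝ[X]) :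
    jacobiInt a b (f + g) = jacobiInt a b f + jacobiInt a b g := by
  simp only [jacobiInt, eval_add]
  exact integral_add (integrable_jacobiMeasure ha hb f.continuous)
    (integrable_jacobiMeasure ha hb g.continuous)

theorem jacobiInt_C_mul (a b c : ℝ) (f : ℝ[X]) :
    jacobiInt a b (C c * f) = c * jacobiInt a b f := by
  simp only [jacobiInt, eval_mul, eval_C]
  exact integral_const_mul _ _

theorem jacobiInt_sub {a b : ℝ} (ha : -1 < a) (hb : -1 < b) (f g : ℝ[X]) :
    jacobiInt a b (f - g) = jacobiInt a b f - jacobiInt a b g := by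
  simp only [jacobiInt, eval_sub]
  exact integral_sub (integrable_jacobiMeasure ha hb f.continuous)
    (integrable_jacobiMeasure ha hb g.continuous)

theorem jacobiInt_X_mul (a b : ℝ) (f : ℝ[X]) :
    jacobiInt a b (X * f) = jacobiInt a (b + 1) f := by
  rw [jacobiInt, jacobiInt, integral_jacobiMeasure, integral_jacobiMeasure]
  refine setIntegral_congr_fun measurableSet_Ioo fun t ht => ?_
  simp only [eval_mul, eval_X]
  rw [Real.rpow_add_one ht.1.ne']
  ring

theorem jacobiInt_one_sub_X_pow_mul (a b : ℝ) (k : ℕ) (f : ℝ[X]) :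
    jacobiInt a b ((1 - X) ^ k * f) = jacobiInt (a + k) b f := by
  rw [jacobiInt, jacobiInt, integral_jacobiMeasure, integral_jacobiMeasure]
  refine setIntegral_congr_fun measurableSet_Ioo fun t ht => ?_
  simp only [eval_mul, eval_pow, eval_sub, eval_one, eval_X]
  rw [Real.rpow_add_natCast (by linarith [ht.2])]
  ring

theorem integral_Ioo_eq_sub_of_hasDerivAt {F F' : ℝ → ℝ} (hF : ContinuousOn F (Set.Icc 0 1))
    (hd : ∀ t ∈ Set.Ioo (0 : ℝ) 1, HasDerivAt F (F' t) t) (hi : IntegrableOn F' (Set.Ioo 0 1)) :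
    ∫ t in Set.Ioo 0 1, F' t = F 1 - F 0 := by
  rw [← integral_Ioc_eq_integral_Ioo, ← intervalIntegral.integral_of_le zero_le_one]
  refine intervalIntegral.integral_eq_sub_of_hasDerivAt_of_le zero_le_one hF hd ?_
  rwa [intervalIntegrable_iff_integrableOn_Ioo_of_le zero_le_one]

/-- The integrand is the derivative of `t^(b + 1) (1 - t)^(a + 1) h`, which vanishes at both ends.
-/
theorem jacobiInt_pearson {a b : ℝ} (ha : -1 < a) (hb : -1 < b) (h : ℝ[X]) :
    jacobiInt a b (X * (1 - X) * derivative h + (C (b + 1) - C (a + b + 2) * X) * h) = 0 := by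
  rw [jacobiInt, integral_jacobiMeasure,
    integral_Ioo_eq_sub_of_hasDerivAt (F := fun t => t ^ (b + 1) * (1 - t) ^ (a + 1) * h.eval t)]
  · simp [Real.zero_rpow (by linarith : b + 1 ≠ 0), Real.zero_rpow (by linarith : a + 1 ≠ 0)]
  · refine Continuous.continuousOn (Continuous.mul (Continuous.mul ?_ ?_) h.continuous)
    · exact continuous_id.rpow_const fun _ => Or.inr (by linarith)
    · exact (continuous_const.sub continuous_id).rpow_const fun _ => Or.inr (by linarith)
  · intro t ht
    have h0 : t ≠ 0 := ht.1.ne'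
    have h1 : 1 - t ≠ 0 := by linarith [ht.2]
    have d1 := (hasDerivAt_id t).rpow_const (p := b + 1) (Or.inl h0)
    have d2 := ((hasDerivAt_const t (1 : ℝ)).sub (hasDerivAt_id t)).rpow_const (p := a + 1)
      (Or.inl h1)
    convert! (d1.mul d2).mul (h.hasDerivAt t) using 1
    simp only [eval_add, eval_mul, eval_sub, eval_X, eval_one, eval_C, id, add_sub_cancel_right,
      Pi.sub_apply, Pi.mul_apply]
    rw [Real.rpow_add_one h0, Real.rpow_add_one h1]
    ring
  · exact integrableOn_jacobiDensity_mul ha hb (Polynomial.continuous _)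

/-- Now the primitive is `(1 - t)^(a + 1) h`, without a factor `t`, so the endpoint `0` contributes.
This is the origin of the point mass. -/
theorem jacobiInt_zero_pearson {a : ℝ} (ha : -1 < a) (h : ℝ[X]) :
    jacobiInt a 0 ((1 - X) * derivative h - C (a + 1) * h) = - h.eval 0 := by
  rw [jacobiInt, integral_jacobiMeasure,
    integral_Ioo_eq_sub_of_hasDerivAt (F := fun t => (1 - t) ^ (a + 1) * h.eval t)]
  · simp [Real.zero_rpow (by linarith : a + 1 ≠ 0)]
  · refine Continuous.continuousOn (Continuous.mul ?_ h.continuous)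
    exact (continuous_const.sub continuous_id).rpow_const fun _ => Or.inr (by linarith)
  · intro t ht
    have h1 : 1 - t ≠ 0 := by linarith [ht.2]
    have d2 := ((hasDerivAt_const t (1 : ℝ)).sub (hasDerivAt_id t)).rpow_const (p := a + 1)
      (Or.inl h1)
    convert! d2.mul (h.hasDerivAt t) using 1
    simp only [eval_mul, eval_sub, eval_X, eval_one, eval_C, id, add_sub_cancel_right,
      Pi.sub_apply, Real.rpow_zero]
    rw [Real.rpow_add_one h1]
    ring
  · exact integrableOn_jacobiDensity_mul ha (by norm_num) (Polynomial.continuous _)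

theorem jacobiInt_jacobiOp_mul {a b : ℝ} (ha : -1 < a) (hb : -1 < b) (f g : ℝ[X]) :
    jacobiInt a b (jacobiOp a b f * g) = jacobiInt a b (f * jacobiOp a b g) := by
  -- Lagrange's identity: `L f * g - f * L g` is the Pearson expression of the Wronskian.
  have h := jacobiInt_pearson ha hb (derivative f * g - f * derivative g)
  rw [← sub_eq_zero, ← jacobiInt_sub ha hb, ← h]
  congr 1
  simp only [jacobiOp, derivative_mul, derivative_sub]
  ring

/-- On monomials `jacobiOp` is triangular: `X^j` goes to `-j (j + a + b + 1) X^j` plus a multiple of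
`X^(j - 1)`. By symmetry of the operator and induction on `j`, the moment is multiplied to zero by
the eigenvalue gap `(n - j) (n + j + a + b + 1)`, which is nonzero. -/
theorem jacobiInt_jacobi_mul_X_pow {a b : ℝ} (ha : -1 < a) (hb : -1 < b) {n j : ℕ} (hj : j < n) :
    jacobiInt a b (jacobi a b n * X ^ j) = 0 := by
  have hne : ∀ j : ℕ, j < n → ((n : ℝ) - j) * (n + j + a + b + 1) ≠ 0 := fun j hj => by
    have h1 : (j : ℝ) + 1 ≤ n := by exact_mod_cast hj
    have h2 : (0 : ℝ) ≤ j := j.cast_nonneg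
    exact mul_ne_zero (by linarith) (by linarith)
  have hsa := fun j : ℕ => jacobiInt_jacobiOp_mul ha hb (jacobi a b n) (X ^ j)
  simp only [jacobiOp_jacobi hb, neg_mul, mul_assoc] at hsa
  simp only [← neg_mul, ← C_neg, jacobiInt_C_mul] at hsa
  induction j with
  | zero =>
    have h0 := hsa 0
    simp only [pow_zero, jacobiOp, derivative_one, derivative_zero, mul_zero, add_zero] at h0
    have h1 : jacobiInt a b 0 = 0 := by simp [jacobiInt]
    rw [h1] at h0
    refine (mul_eq_zero_iff_left (hne 0 hj)).mp ?_
    simp only [pow_zero]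
    push_cast
    linear_combination -h0
  | succ j ih =>
    have h0 := hsa (j + 1)
    have hop : jacobi a b n * jacobiOp a b (X ^ (j + 1)) =
        C (-((j + 1) * (j + 1 + a + b + 1))) * (jacobi a b n * X ^ (j + 1)) +
          C ((j + 1) * (j + 1 + b)) * (jacobi a b n * X ^ j) := by
      have : jacobiOp a b (X ^ (j + 1)) = C (-((j + 1) * (j + 1 + a + b + 1))) * X ^ (j + 1) +
          C ((j + 1) * (j + 1 + b)) * X ^ j := by
        have h2 : (C 2 : ℝ[X]) = 2 := rfl
        rcases j with _ | j
        · simp [jacobiOp, h2]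
          ring
        · simp [jacobiOp, h2]
          ring
      rw [this]
      ring
    rw [hop, jacobiInt_add ha hb, jacobiInt_C_mul, jacobiInt_C_mul, ih (by omega)] at h0
    refine (mul_eq_zero_iff_left (hne (j + 1) hj)).mp ?_
    push_cast
    linear_combination -h0

theorem jacobiInt_sum {a b : ℝ} (ha : -1 < a) (hb : -1 < b) {κ : Type*} (s : Finset κ)
    (F : κ → ℝ[X]) : jacobiInt a b (∑ k ∈ s, F k) = ∑ k ∈ s, jacobiInt a b (F k) := by
  simp only [jacobiInt, eval_finsetSum]
  exact integral_finsetSum _ fun k _ => integrable_jacobiMeasure ha hb (F k).continuous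

theorem jacobiInt_jacobi_mul {a b : ℝ} (ha : -1 < a) (hb : -1 < b) {n : ℕ} {g : ℝ[X]}
    (hg : ∀ k, n ≤ k → g.coeff k = 0) : jacobiInt a b (jacobi a b n * g) = 0 := by
  have h : jacobi a b n * g = ∑ k ∈ Finset.range n, C (g.coeff k) * (jacobi a b n * X ^ k) := by
    have : g = ∑ k ∈ Finset.range n, C (g.coeff k) * X ^ k := by
      ext k
      simp only [finsetSum_coeff, coeff_C_mul_X_pow, Finset.sum_ite_eq, Finset.mem_range]
      split_ifs with hk
      · rfl
      · exact hg k (by omega)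
    conv_lhs => rw [this, Finset.mul_sum]
    refine Finset.sum_congr rfl fun k _ => ?_
    ring
  rw [h, jacobiInt_sum ha hb]
  refine Finset.sum_eq_zero fun k hk => ?_
  rw [jacobiInt_C_mul, jacobiInt_jacobi_mul_X_pow ha hb (Finset.mem_range.mp hk), mul_zero]

theorem jacobiInt_jacobi_mul_jacobi {a b : ℝ} (ha : -1 < a) (hb : -1 < b) {n n' : ℕ}
    (h : n ≠ n') : jacobiInt a b (jacobi a b n * jacobi a b n') = 0 := by
  wlog hlt : n' < n generalizing n n'
  · rw [mul_comm]
    exact this h.symm (by omega)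
  refine jacobiInt_jacobi_mul ha hb fun k hk => ?_
  exact coeff_eq_zero_of_natDegree_lt ((natDegree_jacobi_le _ _ _).trans_lt (by omega))

/-- For `h = (t p_n)'` the Jacobi equation becomes `(1 - t) h' - (a + 1) h = -(n + 1) (n + a + 1)
p_n`. Integrating against `(1 - t)^a` leaves only `h(0) = p_n(0)`, which is known. -/
theorem jacobiInt_jacobi_one {a : ℝ} (ha : -1 < a) (n : ℕ) :
    jacobiInt a 0 (jacobi a 1 n) = (-1) ^ n / (a + 1) := by
  have h := jacobiInt_zero_pearson ha (X * derivative (jacobi a 1 n) + jacobi a 1 n)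
  have ode := jacobiOp_jacobi (α := a) (β := 1) (by norm_num) n
  have : (1 - X) * derivative (X * derivative (jacobi a 1 n) + jacobi a 1 n) -
      C (a + 1) * (X * derivative (jacobi a 1 n) + jacobi a 1 n) =
      C (-((n + 1) * (n + a + 1))) * jacobi a 1 n := by
    simp only [jacobiOp, C_add, C_mul, C_neg, C_1] at ode ⊢
    have h2 : (C 2 : ℝ[X]) = 2 := rfl
    simp only [h2] at ode
    simp only [derivative_add, derivative_mul, derivative_X]
    linear_combination ode
  rw [this, jacobiInt_C_mul] at h
  simp only [eval_add, eval_mul, eval_X, zero_mul, zero_add, eval_zero_jacobi_one ha] at h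
  have h1 : (n : ℝ) + 1 ≠ 0 := by positivity
  have h2 : (n : ℝ) + a + 1 ≠ 0 := by have := n.cast_nonneg (α := ℝ); linarith
  have h3 : a + 1 ≠ 0 := by linarith
  field_simp at h ⊢
  linear_combination -h

/-! ### Krall-type polynomials: orthogonality with a point mass at `0`. -/

/-- The polynomials `(B + (n + 1) (n + a + 1)) p_{n-1} + (B + n (n + a)) p_n`. -/
def krallAux (a B : ℝ) (n : ℕ) : ℝ[X] :=
  C (B + (n + 1) * (n + a + 1)) * jacobiZ a 1 ((n : ℤ) - 1) + C (B + n * (n + a)) * jacobi a 1 n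

theorem krallAux_succ (a B : ℝ) (n : ℕ) :
    krallAux a B (n + 1) = C (B + (n + 2) * (n + a + 2)) * jacobi a 1 n +
      C (B + (n + 1) * (n + a + 1)) * jacobi a 1 (n + 1) := by
  have : ((n + 1 : ℕ) : ℤ) - 1 = Int.ofNat n := by simp
  rw [krallAux, this, jacobiZ]
  push_cast
  ring_nf

theorem coeff_krallAux {a B : ℝ} {n k : ℕ} (h : n < k) : (krallAux a B n).coeff k = 0 := by
  have hc : ∀ m, m < k → (jacobi a 1 m).coeff k = 0 := fun m hm =>
    coeff_eq_zero_of_natDegree_lt ((natDegree_jacobi_le _ _ _).trans_lt hm)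
  rcases n with _ | n
  · have : jacobiZ a 1 (-1) = 0 := rfl
    simp [krallAux, this, hc 0 h]
  · rw [krallAux_succ, coeff_add, coeff_C_mul, coeff_C_mul, hc n (by omega), hc _ h]
    simp

theorem eval_zero_krallAux {a : ℝ} (ha : -1 < a) (B : ℝ) (n : ℕ) :
    (krallAux a B n).eval 0 = (-1) ^ n * B * (2 * n + a + 1) / (a + 1) := by
  have h3 : a + 1 ≠ 0 := by linarith
  rcases n with _ | n
  · have : jacobiZ a 1 (-1) = 0 := rfl
    simp [krallAux, this, eval_zero_jacobi_one ha]
    field_simp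
  · rw [krallAux_succ]
    simp only [eval_add, eval_mul, eval_C, eval_zero_jacobi_one ha]
    field_simp
    push_cast
    ring

/-- Split the polynomial of lower index as `t r + v`. The factor `t` changes the weight to `t (1 -
t)^a`, for which the two Jacobi polynomials in the other one are orthogonal to `r`. Against the
constant `v`, the integral is a difference of the two coefficients, in which `B` cancels; `B` times
it is the negative of the value at `0`. -/
theorem krallAux_orthogonal {a : ℝ} (ha : -1 < a) (B : ℝ) {n n' : ℕ} (h : n ≠ n') :
    B * jacobiInt a 0 (krallAux a B n * krallAux a B n') +
      (krallAux a B n).eval 0 * (krallAux a B n').eval 0 = 0 := by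
  wlog hlt : n' < n generalizing n n'
  · rw [mul_comm (krallAux a B n), mul_comm (eval 0 _)]
    exact this h.symm (by omega)
  obtain ⟨n, rfl⟩ : ∃ k, n = k + 1 := ⟨n - 1, by omega⟩
  have h0 : (-1 : ℝ) < 0 := by norm_num
  have h1 : (-1 : ℝ) < 0 + 1 := by norm_num
  set v := (krallAux a B n').eval 0 with hv
  set r := divX (krallAux a B n') with hr
  have hsplit : krallAux a B n' = X * r + C v := by
    rw [hv, ← coeff_zero_eq_eval_zero]
    exact (X_mul_divX_add _).symm
  -- The larger index is now `n + 1`, so `n' ≤ n` and dividing by `t` leaves degree below `n`: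
  -- enough for orthogonality to `p_n` as well as to `p_(n+1)`.
  have hrc : ∀ k, n ≤ k → r.coeff k = 0 := fun k hk => by
    rw [hr, coeff_divX]
    exact coeff_krallAux (by omega)
  have e : krallAux a B (n + 1) * (X * r + C v) =
      X * (C (B + (n + 2) * (n + a + 2)) * (jacobi a 1 n * r) +
        C (B + (n + 1) * (n + a + 1)) * (jacobi a 1 (n + 1) * r)) +
      C v * (C (B + (n + 2) * (n + a + 2)) * jacobi a 1 n +
        C (B + (n + 1) * (n + a + 1)) * jacobi a 1 (n + 1)) := by
    rw [krallAux_succ]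
    ring
  have h3 : a + 1 ≠ 0 := by linarith
  rw [hsplit, e, jacobiInt_add ha h0, jacobiInt_X_mul, jacobiInt_add ha h1, jacobiInt_C_mul,
    jacobiInt_C_mul, jacobiInt_C_mul, jacobiInt_add ha h0, jacobiInt_C_mul, jacobiInt_C_mul,
    jacobiInt_jacobi_one ha, jacobiInt_jacobi_one ha, zero_add, jacobiInt_jacobi_mul ha
      (by norm_num) hrc, jacobiInt_jacobi_mul ha (by norm_num) (fun k hk => hrc k (by omega)),
    eval_zero_krallAux ha]
  field_simp
  push_cast
  ring

/-- The shift by `s` is absorbed by `(n + s + 1) (n + s + α + 1) = (n + 1) (n + α + 2 s + 1) + s (s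
+ α)`. The alternating sign of `ψ` turns the determinant into a sum. -/
theorem qhat_eq {α : ℝ} (hα : -1 < α) (a₀ : ℝ) (n s : ℕ) :
    qhat α a₀ n s = C ((-1) ^ (n + s) / (α + 1)) *
      krallAux (α + 2 * s) ((α + 1) * a₀ + s * (s + α)) n := by
  have h3 : α + 1 ≠ 0 := by linarith
  have e1 : psi α a₀ ((n : ℤ) + s) = (-1) ^ (n + s) / (α + 1) *
      ((α + 1) * a₀ + s * (s + α) + (n + 1) * (n + (α + 2 * s) + 1)) := by
    have : ((-1 : ℝ)) ^ ((n : ℤ) + s) = (-1) ^ (n + s) := by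
      rw [← Nat.cast_add, zpow_natCast]
    rw [psi, this]
    push_cast
    field_simp
    ring
  have e2 : psi α a₀ ((n : ℤ) + s - 1) = - ((-1) ^ (n + s) / (α + 1) *
      ((α + 1) * a₀ + s * (s + α) + n * (n + (α + 2 * s)))) := by
    have : ((-1 : ℝ)) ^ ((n : ℤ) + s - 1) = - (-1) ^ (n + s) := by
      rw [zpow_sub_one₀ (by norm_num), ← Nat.cast_add, zpow_natCast]
      norm_num
    rw [psi, this]
    push_cast
    field_simp
    ring
  have e3 : jacobiZ (α + 2 * s) 1 n = jacobi (α + 2 * s) 1 n := rfl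
  rw [qhat, Matrix.det_fin_two_of, e1, e2, e3, krallAux]
  simp only [C_mul, C_neg]
  ring

theorem qhat_orthogonal {α : ℝ} (hα : -1 < α) {a₀ : ℝ} (ha₀ : a₀ ≠ 0) (s : ℕ) {n n' : ℕ}
    (h : n ≠ n') :
    (1 + 1 / (a₀ * (α + 1)) * (s * (s + α))) *
        jacobiInt (α + 2 * s) 0 (qhat α a₀ n s * qhat α a₀ n' s) +
      1 / (a₀ * (α + 1)) * ((qhat α a₀ n s).eval 0 * (qhat α a₀ n' s).eval 0) = 0 := by
  have h3 : α + 1 ≠ 0 := by linarith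
  have key := krallAux_orthogonal (a := α + 2 * s) (by have := s.cast_nonneg (α := ℝ); linarith)
    ((α + 1) * a₀ + s * (s + α)) h
  rw [qhat_eq hα, qhat_eq hα]
  set c := (-1) ^ (n + s) / (α + 1)
  set c' := (-1) ^ (n' + s) / (α + 1)
  set u := krallAux (α + 2 * s) ((α + 1) * a₀ + s * (s + α)) n
  set u' := krallAux (α + 2 * s) ((α + 1) * a₀ + s * (s + α)) n'
  rw [show C c * u * (C c' * u') = C (c * c') * (u * u') by rw [C_mul]; ring, jacobiInt_C_mul,
    eval_mul, eval_mul, eval_C, eval_C]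
  have : 1 + 1 / (a₀ * (α + 1)) * (s * (s + α)) =
      1 / (a₀ * (α + 1)) * ((α + 1) * a₀ + s * (s + α)) := by
    field_simp
  rw [this]
  linear_combination (1 / (a₀ * (α + 1)) * (c * c')) * key

end

/-! ### Dirichlet measures on the simplex and their stick-breaking factorization. -/

section

/-- The Dirichlet weight `y₁^{δ₁} ⋯ y_m^{δ_m} (1 - |y|)^{δ_{m+1}}`. -/
def dirichletWeight {m : ℕ} (δ : Fin (m + 1) → ℝ) (y : Fin m → ℝ) : ℝ :=
  (∏ i : Fin m, y i ^ δ i.castSucc) * (1 - ∑ i, y i) ^ δ (Fin.last m)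

/-- The measure on the simplex with the Dirichlet weight as its density. -/
def dirichletMeasure {m : ℕ} (δ : Fin (m + 1) → ℝ) : Measure (Fin m → ℝ) :=
  (volume.restrict (simplex m)).withDensity fun y => ENNReal.ofReal (dirichletWeight δ y)

theorem isCompact_simplex (m : ℕ) : IsCompact (simplex m) := by
  refine (isCompact_Icc (a := (0 : Fin m → ℝ)) (b := 1)).of_isClosed_subset ?_ fun x hx => ?_
  · rw [simplex, Set.ofPred_and, Set.ofPred_forall]
    refine IsClosed.inter (isClosed_iInter fun i => ?_) ?_
    · exact isClosed_le continuous_const (continuous_apply i)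
    · exact isClosed_le (by fun_prop) continuous_const
  · exact ⟨hx.1, fun i =>
      (Finset.single_le_sum (fun j _ => hx.1 j) (Finset.mem_univ i)).trans hx.2⟩

theorem measurableSet_simplex (m : ℕ) : MeasurableSet (simplex m) :=
  (isCompact_simplex m).measurableSet

theorem measurable_dirichletDensity {m : ℕ} (δ : Fin (m + 1) → ℝ) :
    Measurable fun y => ENNReal.ofReal (dirichletWeight δ y) := by
  unfold dirichletWeight
  fun_prop

theorem dirichletWeight_nonneg {m : ℕ} (δ : Fin (m + 1) → ℝ) {y : Fin m → ℝ}
    (hy : y ∈ simplex m) : 0 ≤ dirichletWeight δ y :=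
  mul_nonneg (Finset.prod_nonneg fun i _ => Real.rpow_nonneg (hy.1 i) _)
    (Real.rpow_nonneg (by linarith [hy.2]) _)

theorem ae_mem_simplex {m : ℕ} (δ : Fin (m + 1) → ℝ) :
    ∀ᵐ y ∂dirichletMeasure δ, y ∈ simplex m :=
  (withDensity_absolutelyContinuous _ _).ae_le (ae_restrict_mem (measurableSet_simplex m))

theorem integral_dirichletMeasure {m : ℕ} (δ : Fin (m + 1) → ℝ) (f : (Fin m → ℝ) → ℝ) :
    ∫ y, f y ∂dirichletMeasure δ = ∫ y in simplex m, f y * dirichletWeight δ y := by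
  rw [dirichletMeasure, integral_withDensity_eq_integral_toReal_smul
    (measurable_dirichletDensity δ) (by simp)]
  refine setIntegral_congr_fun (measurableSet_simplex m) fun y hy => ?_
  rw [ENNReal.toReal_ofReal (dirichletWeight_nonneg δ hy), smul_eq_mul, mul_comm]

theorem integrableOn_mul_dirichletWeight {m : ℕ} (δ : Fin (m + 1) → ℝ) {f : (Fin m → ℝ) → ℝ}
    (hf : Integrable f (dirichletMeasure δ)) :
    IntegrableOn (fun y => f y * dirichletWeight δ y) (simplex m) := by
  rw [dirichletMeasure, integrable_withDensity_iff_integrable_smul'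
    (measurable_dirichletDensity δ) (by simp)] at hf
  refine hf.congr (ae_restrict_of_forall_mem (measurableSet_simplex m) fun y hy => ?_)
  simp only
  rw [ENNReal.toReal_ofReal (dirichletWeight_nonneg δ hy), smul_eq_mul, mul_comm]

theorem lintegral_dirichletMeasure {m : ℕ} (δ : Fin (m + 1) → ℝ) {F : (Fin m → ℝ) → ENNReal}
    (hF : Measurable F) : ∫⁻ y, F y ∂dirichletMeasure δ =
      ∫⁻ y, (simplex m).indicator (fun y => ENNReal.ofReal (dirichletWeight δ y) * F y) y := by
  rw [dirichletMeasure, lintegral_withDensity_eq_lintegral_mul _ (measurable_dirichletDensity δ) hF,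
    lintegral_indicator (measurableSet_simplex m)]
  rfl

instance {m : ℕ} (δ : Fin (m + 1) → ℝ) : SFinite (dirichletMeasure δ) := by
  unfold dirichletMeasure
  infer_instance

instance (a b : ℝ) : SFinite (jacobiMeasure a b) := by
  unfold jacobiMeasure
  infer_instance

/-- The parametrization `(t, y) ↦ (t, (1 - t) y)` of the simplex. -/
def stick {m : ℕ} (p : ℝ × (Fin m → ℝ)) : Fin (m + 1) → ℝ := Fin.cons p.1 ((1 - p.1) • p.2)

theorem continuous_stick {m : ℕ} : Continuous (stick : ℝ × (Fin m → ℝ) → _) := by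
  refine continuous_pi fun i => ?_
  refine Fin.cases ?_ (fun i => ?_) i
  · exact continuous_fst
  · simp only [stick, Fin.cons_succ, Pi.smul_apply, smul_eq_mul]
    fun_prop

theorem stick_mem_simplex {m : ℕ} {t : ℝ} (ht : t ∈ Set.Ioo (0 : ℝ) 1) (y : Fin m → ℝ) :
    stick (t, y) ∈ simplex (m + 1) ↔ y ∈ simplex m := by
  have h1 : 0 < 1 - t := by linarith [ht.2]
  simp only [simplex, Set.mem_ofPred_eq, Fin.forall_fin_succ, Fin.sum_univ_succ, stick,
    Fin.cons_zero, Fin.cons_succ, Pi.smul_apply, smul_eq_mul, ← Finset.mul_sum, ht.1.le, true_and,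
    mul_nonneg_iff_of_pos_left h1]
  refine and_congr_right fun _ => ⟨fun h => ?_, fun h => ?_⟩
  · nlinarith
  · nlinarith

/-- The factor `(1 - t)^m` is the Jacobian of `y ↦ (1 - t) y`; the other powers of `1 - t` come from
the weight. -/
theorem dirichletWeight_stick {m : ℕ} (δ : Fin (m + 2) → ℝ) {t : ℝ} (ht : t ∈ Set.Ioo (0 : ℝ) 1)
    {y : Fin m → ℝ} (hy : y ∈ simplex m) :
    (1 - t) ^ m * dirichletWeight δ (stick (t, y)) =
      t ^ δ 0 * (1 - t) ^ ((∑ i : Fin (m + 1), δ i.succ) + (m : ℝ)) *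
        dirichletWeight (fun i => δ i.succ) y := by
  have h1 : 0 < 1 - t := by linarith [ht.2]
  have h2 : 0 ≤ 1 - ∑ i, y i := by linarith [hy.2]
  have e1 : 1 - ∑ i, stick (t, y) i = (1 - t) * (1 - ∑ i, y i) := by
    simp only [Fin.sum_univ_succ, stick, Fin.cons_zero, Fin.cons_succ, Pi.smul_apply, smul_eq_mul,
      ← Finset.mul_sum]
    ring
  have e2 : ∏ i : Fin m, ((1 - t) * y i) ^ δ i.castSucc.succ =
      (1 - t) ^ (∑ i : Fin m, δ i.castSucc.succ) * ∏ i : Fin m, y i ^ δ i.castSucc.succ := by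
    rw [Real.rpow_sum_of_pos h1, ← Finset.prod_mul_distrib]
    exact Finset.prod_congr rfl fun i _ => Real.mul_rpow h1.le (hy.1 i)
  have e3 : ∏ i : Fin (m + 1), stick (t, y) i ^ δ i.castSucc =
      t ^ δ 0 * ∏ i : Fin m, ((1 - t) * y i) ^ δ i.castSucc.succ := by
    rw [Fin.prod_univ_succ]
    rfl
  rw [dirichletWeight, dirichletWeight, e1, e3, e2, Real.mul_rpow h1.le h2,
    Real.rpow_add_natCast h1.ne', Fin.sum_univ_castSucc, Real.rpow_add h1, Fin.succ_last]
  ring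

theorem lintegral_smul_comp {m : ℕ} {r : ℝ} (hr : 0 < r) {H : (Fin m → ℝ) → ENNReal}
    (hH : Measurable H) :
    ∫⁻ z, H z = ∫⁻ y, ENNReal.ofReal (r ^ m) * H (r • y) := by
  have hHr : Measurable fun y => H (r • y) := hH.comp (measurable_const_smul r)
  rw [lintegral_const_mul _ hHr,
    ← lintegral_map hH (measurable_const_smul r), Measure.map_addHaar_smul _ hr.ne',
    lintegral_smul_measure, smul_eq_mul, ← mul_assoc, ← ENNReal.ofReal_mul (by positivity),
    abs_of_pos (by positivity)]
  simp [hr.ne']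

theorem lintegral_fin_succ {m : ℕ} {G : (Fin (m + 1) → ℝ) → ENNReal} (hG : Measurable G) :
    ∫⁻ x, G x = ∫⁻ t : ℝ, ∫⁻ z : Fin m → ℝ, G (Fin.cons t z) := by
  have h := (volume_preserving_piFinSuccAbove (fun _ : Fin (m + 1) => ℝ) 0).symm
  rw [← h.lintegral_comp hG, Measure.volume_eq_prod, lintegral_prod _ (by
    exact (hG.comp (MeasurableEquiv.measurable _)).aemeasurable)]
  simp [MeasurableEquiv.piFinSuccAbove]
  rfl

/-- The stick-breaking factorization of the Dirichlet measure. -/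
theorem dirichletMeasure_eq_map {m : ℕ} (δ : Fin (m + 2) → ℝ) :
    dirichletMeasure δ =
      ((jacobiMeasure ((∑ i : Fin (m + 1), δ i.succ) + (m : ℝ)) (δ 0)).prod
        (dirichletMeasure fun i => δ i.succ)).map stick := by
  -- Testing on nonnegative functions presupposes no integrability, so finiteness of the Dirichlet
  -- measures can be deduced from the factorization.
  refine Measure.ext_of_lintegral _ fun F hF => ?_
  have hFs : Measurable fun p : ℝ × (Fin m → ℝ) => F (stick p) :=
    hF.comp continuous_stick.measurable
  set G := (simplex (m + 1)).indicator fun x => ENNReal.ofReal (dirichletWeight δ x) * F x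
    with hGdef
  have hG : Measurable G :=
    ((measurable_dirichletDensity δ).mul hF).indicator (measurableSet_simplex _)
  rw [lintegral_dirichletMeasure δ hF, lintegral_fin_succ hG,
    lintegral_map hF continuous_stick.measurable, lintegral_prod _ hFs.aemeasurable,
    jacobiMeasure, lintegral_withDensity_eq_lintegral_mul _ (measurable_jacobiDensity _ _)
      hFs.lintegral_prod_right']
  -- The first coordinate of a point of the simplex lies in `[0, 1]`, and the endpoints are
  -- negligible.
  have h0 : ∫⁻ t : ℝ, ∫⁻ z : Fin m → ℝ, G (Fin.cons t z) =
      ∫⁻ t in Set.Ioo 0 1, ∫⁻ z : Fin m → ℝ, G (Fin.cons t z) := by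
    rw [setLIntegral_congr Ioo_ae_eq_Icc, ← lintegral_indicator measurableSet_Icc]
    refine lintegral_congr fun t => ?_
    rw [Set.indicator_apply]
    split_ifs with ht
    · rfl
    · rw [lintegral_eq_zero_of_ae_eq_zero]
      refine Filter.Eventually.of_forall fun z => Set.indicator_of_notMem (fun hz => ht ?_) _
      exact ⟨hz.1 0, (Finset.single_le_sum (fun j _ => hz.1 j) (Finset.mem_univ 0)).trans hz.2⟩
  rw [h0]
  refine setLIntegral_congr_fun measurableSet_Ioo fun t ht => ?_
  have h1 : 0 < 1 - t := by linarith [ht.2]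
  have hGt : Measurable fun z : Fin m → ℝ => G (Fin.cons t z) := by
    refine hG.comp (measurable_pi_lambda _ fun i => ?_)
    refine Fin.cases ?_ (fun i => ?_) i
    · exact measurable_const
    · exact measurable_pi_apply i
  have hFt : Measurable fun y : Fin m → ℝ => F (stick (t, y)) :=
    hFs.comp measurable_prodMk_left
  have hI : Measurable ((simplex m).indicator fun y =>
      ENNReal.ofReal (dirichletWeight (fun i => δ i.succ) y) * F (stick (t, y))) :=
    ((measurable_dirichletDensity _).mul hFt).indicator (measurableSet_simplex _)
  rw [lintegral_smul_comp h1 hGt, Pi.mul_apply, lintegral_dirichletMeasure _ hFt,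
    ← lintegral_const_mul _ hI]
  refine lintegral_congr fun y => ?_
  change _ * G (stick (t, y)) = _
  by_cases hy : y ∈ simplex m
  · rw [hGdef, Set.indicator_of_mem hy, Set.indicator_of_mem ((stick_mem_simplex ht y).mpr hy),
      ← mul_assoc, ← mul_assoc, ← ENNReal.ofReal_mul (by positivity),
      ← ENNReal.ofReal_mul (mul_nonneg (Real.rpow_nonneg ht.1.le _) (Real.rpow_nonneg h1.le _)),
      dirichletWeight_stick δ ht hy]
  · rw [hGdef, Set.indicator_of_notMem hy,
      Set.indicator_of_notMem (fun h => hy ((stick_mem_simplex ht y).mp h)), mul_zero, mul_zero]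

theorem neg_one_lt_sum_add {m : ℕ} {δ : Fin (m + 1) → ℝ} (hδ : ∀ i, -1 < δ i) :
    -1 < (∑ i, δ i) + (m : ℝ) := by
  have h : ∑ _i : Fin (m + 1), (-1 : ℝ) < ∑ i, δ i :=
    Finset.sum_lt_sum_of_nonempty Finset.univ_nonempty fun i _ => hδ i
  simp at h
  linarith

theorem isFiniteMeasure_dirichletMeasure {m : ℕ} {δ : Fin (m + 1) → ℝ} (hδ : ∀ i, -1 < δ i) :
    IsFiniteMeasure (dirichletMeasure δ) := by
  induction m with
  | zero =>
    have h : (fun y => ENNReal.ofReal (dirichletWeight δ y)) = 1 := by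
      ext y
      simp [dirichletWeight]
    rw [dirichletMeasure, h, withDensity_one]
    have : IsFiniteMeasure (volume : Measure (Fin 0 → ℝ)) :=
      ⟨by rw [Measure.volume_pi_eq_dirac]; simp⟩
    infer_instance
  | succ m ih =>
    have h1 := ih fun i => hδ i.succ
    have h2 := isFiniteMeasure_jacobiMeasure (neg_one_lt_sum_add fun i => hδ i.succ) (hδ 0)
    rw [dirichletMeasure_eq_map]
    infer_instance

theorem integrable_dirichletMeasure {m : ℕ} {δ : Fin (m + 1) → ℝ} (hδ : ∀ i, -1 < δ i)
    {f : (Fin m → ℝ) → ℝ} (hf : Continuous f) : Integrable f (dirichletMeasure δ) := by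
  have := isFiniteMeasure_dirichletMeasure hδ
  exact integrable_of_continuous_of_ae_mem (isCompact_simplex m) (ae_mem_simplex δ) hf

open MvPolynomial

theorem eval_aeval_mul_liftSimplex {m N : ℕ} (p : Polynomial ℝ) {R : MvPolynomial (Fin m) ℝ}
    (hR : R.totalDegree ≤ N) {t : ℝ} (ht : t ≠ 1) (y : Fin m → ℝ) :
    eval (stick (t, y)) (Polynomial.aeval (X 0) p * liftSimplex N R) =
      p.eval t * (1 - t) ^ N * eval y R := by
  have h1 : 1 - t ≠ 0 := sub_ne_zero.mpr ht.symm
  rw [map_mul, eval_aeval_X, eval_liftSimplex N R hR _ (by simpa [stick] using ht)]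
  have : (fun i : Fin m => stick (t, y) i.succ / (1 - stick (t, y) 0)) = y := by
    ext i
    simp only [stick, Fin.cons_zero, Fin.cons_succ, Pi.smul_apply, smul_eq_mul]
    field_simp
  rw [this]
  simp only [stick, Fin.cons_zero]
  ring

/-- In stick-breaking coordinates each lift is `(1 - t)^N R(y)`; the powers of `1 - t` join the
exponent of the Jacobi weight. -/
theorem integral_mul_liftSimplex {m N N' : ℕ} (δ : Fin (m + 2) → ℝ) (p p' : Polynomial ℝ)
    {R R' : MvPolynomial (Fin m) ℝ} (hR : R.totalDegree ≤ N) (hR' : R'.totalDegree ≤ N') :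
    ∫ x, eval x (Polynomial.aeval (X 0) p * liftSimplex N R) *
        eval x (Polynomial.aeval (X 0) p' * liftSimplex N' R') ∂dirichletMeasure δ =
      jacobiInt ((∑ i : Fin (m + 1), δ i.succ) + (m : ℝ) + (N + N' : ℕ)) (δ 0) (p * p') *
        ∫ y, eval y R * eval y R' ∂dirichletMeasure fun i => δ i.succ := by
  rw [dirichletMeasure_eq_map, integral_map continuous_stick.measurable.aemeasurable
    (by
      refine Continuous.aestronglyMeasurable ?_
      exact (MvPolynomial.continuous_eval _).mul (MvPolynomial.continuous_eval _)),
    ← jacobiInt_one_sub_X_pow_mul, jacobiInt, ← integral_prod_mul]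
  refine integral_congr_ae ?_
  have h : ∀ᵐ z ∂((jacobiMeasure ((∑ i : Fin (m + 1), δ i.succ) + (m : ℝ)) (δ 0)).prod
      (dirichletMeasure fun i => δ i.succ)), z.1 ∈ Set.Ioo (0 : ℝ) 1 :=
    Measure.quasiMeasurePreserving_fst.ae (ae_mem_Ioo_jacobiMeasure _ _)
  filter_upwards [h] with z hz
  obtain ⟨t, y⟩ := z
  have ht : t ≠ 1 := hz.2.ne
  rw [eval_aeval_mul_liftSimplex _ hR ht, eval_aeval_mul_liftSimplex _ hR' ht]
  simp
  ring

theorem integral_simplexJacobi_mul {m : ℕ} {δ : Fin (m + 1) → ℝ} (hδ : ∀ i, -1 < δ i)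
    {η ξ : Fin m → ℕ} (h : η ≠ ξ) :
    ∫ y, eval y (simplexJacobi m δ η) * eval y (simplexJacobi m δ ξ) ∂dirichletMeasure δ = 0 := by
  induction m with
  | zero => exact absurd (Subsingleton.elim _ _) h
  | succ m ih =>
    rw [simplexJacobi, simplexJacobi, integral_mul_liftSimplex δ _ _
      (totalDegree_simplexJacobi_le _ _ _) (totalDegree_simplexJacobi_le _ _ _)]
    by_cases ht : (fun i : Fin m => η i.succ) = fun i => ξ i.succ
    · have hs : ∑ i : Fin m, ξ i.succ = ∑ i : Fin m, η i.succ :=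
        Finset.sum_congr rfl fun i _ => (congrFun ht i).symm
      have h0 : η 0 ≠ ξ 0 := fun h0 => h (funext (Fin.cases h0 (congrFun ht)))
      have ha := neg_one_lt_sum_add fun i => hδ (Fin.succ i)
      -- Equal tails give `N + N' = 2 N`, so the weight has exactly the parameter of both Jacobi
      -- polynomials.
      have he : (∑ i : Fin (m + 1), δ i.succ) + (m : ℝ) +
          (∑ i : Fin m, η i.succ + ∑ i : Fin m, η i.succ : ℕ) =
          2 * (∑ i : Fin m, η i.succ : ℕ) + (∑ i : Fin (m + 1), δ i.succ) + (m : ℝ) := by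
        push_cast
        ring
      rw [hs, he, jacobiInt_jacobi_mul_jacobi _ (hδ 0) h0, zero_mul]
      have := (∑ i : Fin m, η i.succ).cast_nonneg (α := ℝ)
      linarith
    · rw [ih (fun i => hδ i.succ) ht, mul_zero]

end

/-! ### Separation of the Sobolev form. -/

section

open MvPolynomial

/-- The parameters of the Dirichlet weight in all variables that is equal to `weight γ`. -/
def weightParams {m : ℕ} (γ : Fin (m + 2) → ℝ) : Fin (m + 2) → ℝ := Function.update γ 0 0

theorem weightParams_zero {m : ℕ} (γ : Fin (m + 2) → ℝ) : weightParams γ 0 = 0 :=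
  Function.update_self ..

theorem weightParams_succ {m : ℕ} (γ : Fin (m + 2) → ℝ) (i : Fin (m + 1)) :
    weightParams γ i.succ = γ i.succ :=
  Function.update_of_ne (Fin.succ_ne_zero i) ..

theorem neg_one_lt_weightParams {m : ℕ} {γ : Fin (m + 2) → ℝ} (hγ : ∀ i, -1 < γ i)
    (i : Fin (m + 2)) : -1 < weightParams γ i := by
  refine Fin.cases ?_ (fun i => ?_) i
  · rw [weightParams_zero]
    norm_num
  · rw [weightParams_succ]
    exact hγ _

theorem weight_eq {m : ℕ} (γ : Fin (m + 2) → ℝ) (x : Fin (m + 1) → ℝ) :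
    weight γ x = dirichletWeight (weightParams γ) x := by
  rw [weight, dirichletWeight, Fin.prod_univ_succ, Fin.castSucc_zero, weightParams_zero,
    Real.rpow_zero, one_mul, ← Fin.succ_last, weightParams_succ]
  simp only [← Fin.succ_castSucc, weightParams_succ]

theorem weight_cons_zero {m : ℕ} (γ : Fin (m + 2) → ℝ) (y : Fin m → ℝ) :
    weight γ (Fin.cons 0 y) = dirichletWeight (fun i => γ i.succ) y := by
  simp [weight, dirichletWeight, Fin.sum_univ_succ]

theorem integrableOn_mul_weight {m : ℕ} {γ : Fin (m + 2) → ℝ} (hγ : ∀ i, -1 < γ i)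
    {f : (Fin (m + 1) → ℝ) → ℝ} (hf : Continuous f) :
    IntegrableOn (fun x => f x * weight γ x) (simplex (m + 1)) := by
  simp only [weight_eq]
  exact integrableOn_mul_dirichletWeight _
    (integrable_dirichletMeasure (neg_one_lt_weightParams hγ) hf)

theorem integrableOn_mul_weight_cons_zero {m : ℕ} {γ : Fin (m + 2) → ℝ} (hγ : ∀ i, -1 < γ i)
    {f : (Fin m → ℝ) → ℝ} (hf : Continuous f) :
    IntegrableOn (fun y => f y * weight γ (Fin.cons 0 y)) (simplex m) := by
  simp only [weight_cons_zero]
  exact integrableOn_mul_dirichletWeight _ (integrable_dirichletMeasure (fun i => hγ i.succ) hf)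

theorem opM2_krallQ {m : ℕ} {γ : Fin (m + 2) → ℝ} (hγ : ∀ i, -1 < γ i) (a₀ : ℝ)
    (η : Fin (m + 1) → ℕ) :
    opM2 γ (krallQ γ a₀ η) = C (-((∑ i : Fin m, η i.succ : ℕ) *
      ((∑ i : Fin m, η i.succ : ℕ) + ((∑ j : Fin (m + 1), γ j.succ) + m)))) * krallQ γ a₀ η := by
  rw [krallQ, opM2_aeval_mul, opM2_liftSimplex γ (totalDegree_simplexJacobi_le _ _ _)
    (isSimplexEigen_simplexJacobi m _ (fun i => hγ i.succ) _), C_neg]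
  ring

theorem eval_cons_zero_krallQ {m : ℕ} (γ : Fin (m + 2) → ℝ) (a₀ : ℝ) (η : Fin (m + 1) → ℕ)
    (y : Fin m → ℝ) :
    eval (Fin.cons 0 y : Fin (m + 1) → ℝ) (krallQ γ a₀ η) =
      (qhat ((∑ i : Fin (m + 1), γ i.succ) + (m : ℝ)) a₀ (η 0) (∑ i : Fin m, η i.succ)).eval 0 *
        eval y (simplexJacobi m (fun i => γ i.succ) (fun i => η i.succ)) := by
  rw [eval_krallQ _ _ _ _ (by simp)]
  simp

/-- The volume and boundary weights leave the same Dirichlet measure in `y`, so its integral factors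
out of all three terms. The third is the first times the eigenvalue of `opM2`, which only sees the
tail of `η`. -/
theorem sobolevForm_krallQ {m : ℕ} {γ : Fin (m + 2) → ℝ} (hγ : ∀ i, -1 < γ i) (a₀ : ℝ)
    (η ξ : Fin (m + 1) → ℕ) {s s' : ℕ} (hs : ∑ i : Fin m, η i.succ = s)
    (hs' : ∑ i : Fin m, ξ i.succ = s') {α : ℝ} (hα : (∑ i : Fin (m + 1), γ i.succ) + (m : ℝ) = α) :
    sobolevForm γ a₀ (krallQ γ a₀ η) (krallQ γ a₀ ξ) =
      ((1 + 1 / (a₀ * (α + 1)) * (s * (s + α))) *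
          jacobiInt (α + (s + s' : ℕ)) 0 (qhat α a₀ (η 0) s * qhat α a₀ (ξ 0) s') +
        1 / (a₀ * (α + 1)) * ((qhat α a₀ (η 0) s).eval 0 * (qhat α a₀ (ξ 0) s').eval 0)) *
      ∫ y, eval y (simplexJacobi m (fun i => γ i.succ) (fun i => η i.succ)) *
        eval y (simplexJacobi m (fun i => γ i.succ) (fun i => ξ i.succ))
        ∂dirichletMeasure fun i => γ i.succ := by
  have h1 : ∫ x in simplex (m + 1),
      eval x (krallQ γ a₀ η) * eval x (krallQ γ a₀ ξ) * weight γ x =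
      jacobiInt (α + (s + s' : ℕ)) 0 (qhat α a₀ (η 0) s * qhat α a₀ (ξ 0) s') *
        ∫ y, eval y (simplexJacobi m (fun i => γ i.succ) (fun i => η i.succ)) *
          eval y (simplexJacobi m (fun i => γ i.succ) (fun i => ξ i.succ))
          ∂dirichletMeasure fun i => γ i.succ := by
    simp only [weight_eq]
    rw [← integral_dirichletMeasure, krallQ, krallQ,
      integral_mul_liftSimplex _ _ _ (totalDegree_simplexJacobi_le _ _ _)
        (totalDegree_simplexJacobi_le _ _ _), hs, hs']
    simp only [weightParams_zero, weightParams_succ, hα]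
  have h2 : ∫ y in simplex m, eval (Fin.cons 0 y : Fin (m + 1) → ℝ) (krallQ γ a₀ η) *
      eval (Fin.cons 0 y : Fin (m + 1) → ℝ) (krallQ γ a₀ ξ) * weight γ (Fin.cons 0 y) =
      ((qhat α a₀ (η 0) s).eval 0 * (qhat α a₀ (ξ 0) s').eval 0) *
        ∫ y, eval y (simplexJacobi m (fun i => γ i.succ) (fun i => η i.succ)) *
          eval y (simplexJacobi m (fun i => γ i.succ) (fun i => ξ i.succ))
          ∂dirichletMeasure fun i => γ i.succ := by
    simp only [weight_cons_zero]
    rw [← integral_dirichletMeasure, ← integral_const_mul]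
    refine integral_congr_ae (Filter.Eventually.of_forall fun y => ?_)
    simp only [eval_cons_zero_krallQ, hs, hs', hα]
    ring
  have h3 : ∫ x in simplex (m + 1),
      eval x (opM2 γ (krallQ γ a₀ η)) * eval x (krallQ γ a₀ ξ) * weight γ x =
      -(s * (s + α)) * ∫ x in simplex (m + 1),
        eval x (krallQ γ a₀ η) * eval x (krallQ γ a₀ ξ) * weight γ x := by
    rw [opM2_krallQ hγ, ← integral_const_mul, hs, hα]
    simp only [map_mul, eval_C, mul_assoc]
  rw [sobolevForm, h3, h1, h2, ← add_assoc, hα]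
  ring

end

end SimplexKrall

end

theorem mainTheorem4 (m : ℕ) (γ : Fin (m + 2) → ℝ) (hγ : ∀ i, -1 < γ i) (hγ₁ : γ 0 = 1)
    (a₀ : ℝ) (ha₀ : a₀ ≠ 0) :
    (∀ f g : MvPolynomial (Fin (m + 1)) ℝ,
      IntegrableOn (fun x => MvPolynomial.eval x f * MvPolynomial.eval x g * SimplexKrall.weight γ x)
          (SimplexKrall.simplex (m + 1)) ∧
      IntegrableOn (fun y => MvPolynomial.eval (Fin.cons 0 y : Fin (m + 1) → ℝ) f *
          MvPolynomial.eval (Fin.cons 0 y : Fin (m + 1) → ℝ) g * SimplexKrall.weight γ (Fin.cons 0 y))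
          (SimplexKrall.simplex m) ∧
      IntegrableOn (fun x => MvPolynomial.eval x (SimplexKrall.opM2 γ f) * MvPolynomial.eval x g *
          SimplexKrall.weight γ x)
          (SimplexKrall.simplex (m + 1))) ∧
    ∀ η ξ : Fin (m + 1) → ℕ, η ≠ ξ →
      SimplexKrall.sobolevForm γ a₀ (SimplexKrall.krallQ γ a₀ η) (SimplexKrall.krallQ γ a₀ ξ) = 0 := by
  refine ⟨fun f g => ⟨?_, ?_, ?_⟩, fun η ξ h => ?_⟩
  · exact SimplexKrall.integrableOn_mul_weight hγ
      (f.continuous_eval.mul g.continuous_eval)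
  · have hc : Continuous fun y : Fin m → ℝ => (Fin.cons 0 y : Fin (m + 1) → ℝ) :=
      continuous_pi fun i => Fin.cases continuous_const (fun i => continuous_apply i) i
    exact SimplexKrall.integrableOn_mul_weight_cons_zero hγ
      ((f.continuous_eval.comp hc).mul (g.continuous_eval.comp hc))
  · exact SimplexKrall.integrableOn_mul_weight hγ
      ((SimplexKrall.opM2 γ f).continuous_eval.mul g.continuous_eval)
  · rw [SimplexKrall.sobolevForm_krallQ hγ a₀ η ξ rfl rfl rfl]
    -- Equal tails: the one-variable factor vanishes. Different tails: the Dirichlet factor does,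
    -- even when their sums coincide.
    by_cases ht : (fun i : Fin m => η i.succ) = fun i => ξ i.succ
    · have hs : ∑ i : Fin m, ξ i.succ = ∑ i : Fin m, η i.succ :=
        Finset.sum_congr rfl fun i _ => (congrFun ht i).symm
      have h0 : η 0 ≠ ξ 0 := fun h0 => h (funext (Fin.cases h0 (congrFun ht)))
      have key := SimplexKrall.qhat_orthogonal
        (SimplexKrall.neg_one_lt_sum_add fun i => hγ (Fin.succ i)) ha₀ (∑ i : Fin m, η i.succ) h0
      rw [hs, Nat.cast_add, ← two_mul, key, zero_mul]
    · rw [SimplexKrall.integral_simplexJacobi_mul (fun i => hγ i.succ) ht, mul_zero]
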